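/- Let $d\ge 3$ and $k\ge 0$ be integers. Let $\mathcal P^*_{2k}(\mathbb R^d)$ be the space of even real polynomials (i.e. $f(-x)=f(x)$) in $d$ variables of degree at most $2k$, with the inner product given by the integral $$\langle f,g\rangle=\int_{\{x\in\mathbb R^d:\ \|x\|\ge 1\}} f(x)\,g(x)\,\frac{\sqrt{\|x\|^2-1}}{\|x\|^{4k+d+2}}\,dx .$$ This integral converges absolutely for all $f,g\in\mathcal P^*_{2k}(\mathbb R^d)$. Let $K_{2k}(x,y)=\sum_i b_i(x)b_i(y)$, where $(b_i)$ is an orthonormal basis of $\mathcal P^*_{2k}(\mathbb R^d)$ for this inner product, be the reproducing kernel of $\mathcal P^*_{2k}(\mathbb R^d)$; such a basis exists, and $K_{2k}$ does not depend on its choice. Then for all $x,y\in\mathbb R^d\setminus\{0\}$, $$K_{2k}(x,y)=\frac{4(\|x\|\|y\|)^{2k}}{\pi(d-2)|S^{d-1}|}\sum_{m=0}^{k}\sum_{j=0}^{k-m}(d+4m-2)\,C_{2j}^{(1)}\!\Big(\frac1{\|x\|}\Big)C_{2j}^{(1)}\!\Big(\frac1{\|y\|}\Big)C_{2m}^{((d-2)/2)}\!\Big(\frac{\langle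 x,y\rangle}{\|x\|\|y\|}\Big).$$ In this formula $\langle x,y\rangle$ is the Euclidean inner product, $|S^{d-1}|$ is the surface area of the unit sphere of $\mathbb R^d$, and $C_l^{(\lambda)}$ is the Gegenbauer polynomial $$C_l^{(\lambda)}(t)=\sum_{j=0}^{\lfloor l/2\rfloor}(-1)^j\frac{\lambda(\lambda+1)\cdots(\lambda+l-j-1)}{j!\,(l-2j)!}(2t)^{l-2j}.$$ -/

import Mathlib

open MeasureTheory

noncomputable section

/-- The Gegenbauer polynomial `C_l^{(lam)}`, as an actual polynomial, through its explicit form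
`C_l^{(lam)}(t) = ∑_{j ≤ l/2} (-1)^j (lam)_{l-j} / (j! (l-2j)!) (2t)^{l-2j}`,
where `(lam)_n = lam (lam+1) ⋯ (lam+n-1)` is the rising factorial. -/
def gegenbauer (l : ℕ) (lam : ℝ) : Polynomial ℝ :=
  ∑ j ∈ Finset.range (l / 2 + 1),
    Polynomial.C ((-1) ^ j * (ascPochhammer ℝ (l - j)).eval lam
        / ((Nat.factorial j : ℝ) * (Nat.factorial (l - 2 * j) : ℝ)))
      * (2 * Polynomial.X) ^ (l - 2 * j)

/-- The value at `x ∈ ℝ^d` of a real polynomial in `d` variables. -/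
def polyEval {d : ℕ} (x : EuclideanSpace ℝ (Fin d)) (p : MvPolynomial (Fin d) ℝ) : ℝ :=
  MvPolynomial.eval x.ofLp p

/-- `P*_{2k}(ℝ^d)`: the even real polynomials in `d` variables of degree at most `2k`. -/
def evenPolys (d k : ℕ) : Submodule ℝ (MvPolynomial (Fin d) ℝ) where
  carrier := {p | p.totalDegree ≤ 2 * k ∧
    ∀ x : EuclideanSpace ℝ (Fin d), polyEval (-x) p = polyEval x p}
  add_mem' := by
    rintro p q ⟨hp, hp'⟩ ⟨hq, hq'⟩
    refine ⟨(MvPolynomial.totalDegree_add p q).trans (max_le hp hq), fun x => ?_⟩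
    have h1 := hp' x
    have h2 := hq' x
    simp only [polyEval, map_add] at *
    rw [h1, h2]
  zero_mem' := by simp [polyEval]
  smul_mem' := by
    rintro c p ⟨hp, hp'⟩
    refine ⟨(MvPolynomial.totalDegree_smul_le c p).trans hp, fun x => ?_⟩
    have h1 := hp' x
    simp only [polyEval, MvPolynomial.smul_eval] at *
    rw [h1]

/-- The domain `Ω = {x ∈ ℝ^d | 1 ≤ ‖x‖ < ∞}`. -/
def domainΩ (d : ℕ) : Set (EuclideanSpace ℝ (Fin d)) := {x | 1 ≤ ‖x‖}

/-- The weight `W(r) = √(r² - 1) / r^{4k+d+2}` (used for `r ≥ 1`). -/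
def weightW (d k : ℕ) (r : ℝ) : ℝ := Real.sqrt (r ^ 2 - 1) / r ^ (4 * k + d + 2)

/-- The integral `∫_Ω f(x) W(‖x‖) dx`. -/
def specialIntegral (d k : ℕ) (f : EuclideanSpace ℝ (Fin d) → ℝ) : ℝ :=
  ∫ x in domainΩ d, f x * weightW d k ‖x‖

/-- A basis of `P*_{2k}(ℝ^d)` that is orthonormal for the pairing `∫_Ω p q W(‖x‖) dx`. -/
def IsOrthonormalBasis (d k : ℕ) {n : ℕ} (b : Module.Basis (Fin n) ℝ (evenPolys d k)) : Prop :=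
  ∀ i j : Fin n,
    specialIntegral d k (fun x => polyEval x (b i : MvPolynomial (Fin d) ℝ)
      * polyEval x (b j : MvPolynomial (Fin d) ℝ)) = if i = j then 1 else 0

/-- `K` is the reproducing kernel `K(x,y) = ∑_i b_i(x) b_i(y)` of `P*_{2k}(ℝ^d)` with respect to
`Ω` for `W`, formed with some orthonormal basis `(b_i)`. -/
def IsReproducingKernel (d k : ℕ)
    (K : EuclideanSpace ℝ (Fin d) → EuclideanSpace ℝ (Fin d) → ℝ) : Prop :=
  ∃ (n : ℕ) (b : Module.Basis (Fin n) ℝ (evenPolys d k)), IsOrthonormalBasis d k b ∧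
    ∀ x y, K x y = ∑ i, polyEval x (b i : MvPolynomial (Fin d) ℝ)
      * polyEval y (b i : MvPolynomial (Fin d) ℝ)

/-- The surface area `|S^{d-1}|` of the unit sphere of `ℝ^d`. -/
def sphereArea (d : ℕ) : ℝ :=
  ((volume : Measure (EuclideanSpace ℝ (Fin d))).toSphere Set.univ).toReal

end

/-! By uniqueness of the representer of an evaluation functional (`IsOrthonormalBasis.kernel_eq`),
it suffices that the claimed formula, read as a function of y for fixed x ≠ 0, is an even polynomial
of degree at most 2k (`kernelSection`) whose pairing with every p in the space is p(x). Even
polynomials are spanned by homogeneous ones of even degree, so p may be taken homogeneous of degree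
2a with a ≤ k.

In polar coordinates the pairing of p with the term of index (m, j) splits into an angular and a
radial factor (`weightedPairing_radialPoly_mul_zonalPoly`). The angular factor is the integral over
the sphere of p against the zonal harmonic of degree 2m. After t = 1/r, the radial factor is the
integral over [0, 1] of t^(2(k-a)) against C_{2j}^{(1)}(t) with weight √(1-t²).

Since C_{2j}^{(1)} is the Chebyshev polynomial U_{2j}, and the U of even degree are orthogonal on
the half interval with squared norm π/4, the sum over j ≤ k-m returns (π/4)‖x‖^(-2(k-a)) as soon as
m ≤ a (`sum_U_mul_semicirclePairing`). For m > a the angular factor is zero, a harmonic being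
orthogonal to all homogeneous polynomials of lower degree. Hence the radial sum does not depend on m
where it matters, and the sum over m is the reproducing formula of zonal harmonics, (d-2)|S^{d-1}|
p(x/‖x‖) (`sum_sphereIntegral_mul_zonalPoly`). The prefactor turns the product into ‖x‖^(2a)
p(x/‖x‖) = p(x).

The spherical facts follow from one divergence identity, `sphereIntegral_pderiv`, obtained by
integrating by parts against a Gaussian. -/

noncomputable section

/-! ### Algebra of the Laplacian and zonal harmonics. -/

/-- The polynomial `X₁² + ⋯ + X_d²`. -/
def normSqPoly (d : ℕ) : MvPolynomial (Fin d) ℝ := ∑ i, MvPolynomial.X i ^ 2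

/-- The Laplacian on polynomials. -/
def polyLaplacian (d : ℕ) : MvPolynomial (Fin d) ℝ →ₗ[ℝ] MvPolynomial (Fin d) ℝ :=
  ∑ i, (MvPolynomial.pderiv i).toLinearMap ∘ₗ (MvPolynomial.pderiv i).toLinearMap

/-- The linear form `x ↦ ⟨ξ, x⟩` as a polynomial. -/
def linearFormPoly {d : ℕ} (ξ : EuclideanSpace ℝ (Fin d)) : MvPolynomial (Fin d) ℝ :=
  ∑ i, MvPolynomial.C (ξ i) * MvPolynomial.X i

namespace MvPolynomial

variable {d : ℕ}

theorem polyLaplacian_apply (p : MvPolynomial (Fin d) ℝ) :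
    polyLaplacian d p = ∑ i, pderiv i (pderiv i p) := by
  simp [polyLaplacian]

theorem isHomogeneous_normSqPoly : (normSqPoly d).IsHomogeneous 2 :=
  IsHomogeneous.sum _ _ _ fun i _ => isHomogeneous_X_pow i 2

theorem isHomogeneous_linearFormPoly (ξ : EuclideanSpace ℝ (Fin d)) :
    (linearFormPoly ξ).IsHomogeneous 1 :=
  IsHomogeneous.sum _ _ _ fun i _ => isHomogeneous_C_mul_X _ i

theorem IsHomogeneous.polyLaplacian {p : MvPolynomial (Fin d) ℝ} {n : ℕ}
    (hp : p.IsHomogeneous n) : (polyLaplacian d p).IsHomogeneous (n - 2) := by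
  rw [polyLaplacian_apply]
  exact IsHomogeneous.sum _ _ _ fun i _ => hp.pderiv.pderiv

theorem IsHomogeneous.iterate_polyLaplacian {p : MvPolynomial (Fin d) ℝ} {n : ℕ}
    (hp : p.IsHomogeneous n) (j : ℕ) :
    ((_root_.polyLaplacian d)^[j] p).IsHomogeneous (n - 2 * j) := by
  induction j with
  | zero => simpa using hp
  | succ j ih =>
    rw [Function.iterate_succ_apply']
    exact ih.polyLaplacian

theorem IsHomogeneous.pderiv_eq_zero {p : MvPolynomial (Fin d) ℝ}
    (hp : p.IsHomogeneous 0) (i : Fin d) : pderiv i p = 0 := by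
  rw [totalDegree_eq_zero_iff_eq_C.1 ((totalDegree_zero_iff_isHomogeneous _).2 hp), pderiv_C]

theorem IsHomogeneous.polyLaplacian_eq_zero {p : MvPolynomial (Fin d) ℝ} {n : ℕ}
    (hp : p.IsHomogeneous n) (hn : n < 2) : _root_.polyLaplacian d p = 0 := by
  rw [polyLaplacian_apply]
  refine Finset.sum_eq_zero fun i _ => ?_
  have h : (pderiv i p).IsHomogeneous 0 := by
    have := hp.pderiv (i := i)
    rwa [show n - 1 = 0 by omega] at this
  exact h.pderiv_eq_zero i

/-- The commutator of two derivations is a derivation, and this one vanishes on the variables. -/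
theorem pderiv_pderiv_comm (i j : Fin d) (p : MvPolynomial (Fin d) ℝ) :
    pderiv i (pderiv j p) = pderiv j (pderiv i p) := by
  let D : Fin d → Derivation ℝ (MvPolynomial (Fin d) ℝ) (MvPolynomial (Fin d) ℝ) :=
    fun i => pderiv i
  have h : ⁅D i, D j⁆ = 0 := derivation_ext fun k => by
    rw [Derivation.commutator_apply]
    simp [D, pderiv_X, Pi.single_apply, apply_ite (pderiv _)]
  have := congrArg (fun E => E p) h
  rw [Derivation.commutator_apply] at this
  exact sub_eq_zero.1 this

theorem polyLaplacian_comm_pderiv (p : MvPolynomial (Fin d) ℝ) (i : Fin d) :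
    polyLaplacian d (pderiv i p) = pderiv i (polyLaplacian d p) := by
  simp only [polyLaplacian_apply, map_sum]
  refine Finset.sum_congr rfl fun j _ => ?_
  rw [pderiv_pderiv_comm j i p, pderiv_pderiv_comm j i]

theorem pderiv_normSqPoly (i : Fin d) : pderiv i (normSqPoly d) = 2 * X i := by
  simp only [normSqPoly, map_sum, pderiv_pow, pderiv_X]
  rw [Finset.sum_eq_single i]
  · simp
  · intro j _ hj
    simp [hj]
  · simp

theorem pderiv_linearFormPoly (ξ : EuclideanSpace ℝ (Fin d)) (i : Fin d) :
    pderiv i (linearFormPoly ξ) = C (ξ i) := by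
  simp only [linearFormPoly, map_sum, pderiv_C_mul, pderiv_X]
  rw [Finset.sum_eq_single i]
  · simp
  · intro j _ hj
    simp [hj]
  · simp

/-- Leibniz' rule; the cross terms 4 x_i ∂_i p add up to 4np by Euler's identity. -/
theorem polyLaplacian_normSqPoly_mul {p : MvPolynomial (Fin d) ℝ} {n : ℕ}
    (hp : p.IsHomogeneous n) :
    polyLaplacian d (normSqPoly d * p) =
      C (2 * ((d : ℝ) + 2 * n)) * p + normSqPoly d * polyLaplacian d p := by
  have he : ∑ i, X i * pderiv i p = C (n : ℝ) * p := by
    rw [hp.sum_X_mul_pderiv, nsmul_eq_mul, map_natCast]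
  have hi : ∀ i : Fin d, pderiv i (pderiv i (normSqPoly d * p)) =
      2 * p + 4 * (X i * pderiv i p) + normSqPoly d * pderiv i (pderiv i p) := by
    intro i
    have h2 : pderiv i (2 : MvPolynomial (Fin d) ℝ) = 0 := by
      rw [show (2 : MvPolynomial (Fin d) ℝ) = C 2 from rfl, pderiv_C]
    simp only [pderiv_mul, map_add, pderiv_normSqPoly, pderiv_X_self, h2]
    ring
  rw [polyLaplacian_apply, Finset.sum_congr rfl fun i _ => hi i]
  simp only [Finset.sum_add_distrib, ← Finset.mul_sum, he, polyLaplacian_apply, Finset.sum_const,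
    Finset.card_univ, Fintype.card_fin, nsmul_eq_mul, map_mul, map_add, map_natCast, map_ofNat]
  ring

theorem polyLaplacian_normSqPoly_pow_mul {p : MvPolynomial (Fin d) ℝ} {n : ℕ}
    (hp : p.IsHomogeneous n) (j : ℕ) :
    polyLaplacian d (normSqPoly d ^ (j + 1) * p) =
      C (2 * ((j : ℝ) + 1) * (2 * j + d + 2 * n)) * (normSqPoly d ^ j * p)
        + normSqPoly d ^ (j + 1) * polyLaplacian d p := by
  induction j with
  | zero =>
    simp only [zero_add, pow_one, pow_zero, one_mul]
    rw [polyLaplacian_normSqPoly_mul hp]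
    simp
  | succ j ih =>
    have hq : (normSqPoly d ^ (j + 1) * p).IsHomogeneous (2 * (j + 1) + n) :=
      (isHomogeneous_normSqPoly.pow _).mul hp
    rw [pow_succ' _ (j + 1), mul_assoc, polyLaplacian_normSqPoly_mul hq, ih]
    simp only [map_mul, map_add, map_natCast, map_ofNat, Nat.cast_add, Nat.cast_mul, map_one,
      Nat.cast_one, Nat.cast_ofNat]
    ring

/-- The combination `∑ c_j |x|^{2j} Δ^j p`. -/
def laplaceSeries (c : ℕ → ℝ) (n : ℕ) (p : MvPolynomial (Fin d) ℝ) : MvPolynomial (Fin d) ℝ :=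
  ∑ j ∈ Finset.range (n / 2 + 1), C (c j) * (normSqPoly d ^ j * (polyLaplacian d)^[j] p)

/-- The recursion on `c` makes Δ of the series telescope: the term c_{j+1}|x|^(2j) Δ^(j+1) p coming
from |x|^(2j+2) cancels what is left of the term before it. -/
theorem polyLaplacian_laplaceSeries {p : MvPolynomial (Fin d) ℝ} {n : ℕ}
    (hp : p.IsHomogeneous n) {c : ℕ → ℝ}
    (hc : ∀ j, 2 * (j + 1) ≤ n →
      c (j + 1) * (2 * ((j : ℝ) + 1) * (2 * n + d - 4 - 2 * j)) = -c j) :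
    polyLaplacian d (laplaceSeries c n p) = 0 := by
  have key : ∀ N, N ≤ n / 2 → polyLaplacian d
      (∑ j ∈ Finset.range (N + 1), C (c j) * (normSqPoly d ^ j * (polyLaplacian d)^[j] p)) =
      C (c N) * (normSqPoly d ^ N * (polyLaplacian d)^[N + 1] p) := by
    intro N
    induction N with
    | zero => intro _; simp [← smul_eq_C_mul]
    | succ N ih =>
      intro hN
      have hN' : 2 * (N + 1) ≤ n := by omega
      rw [Finset.sum_range_succ, map_add, ih (by omega), ← smul_eq_C_mul (_ * _) (c (N + 1)),
        map_smul, polyLaplacian_normSqPoly_pow_mul (hp.iterate_polyLaplacian (N + 1)),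
        Function.iterate_succ_apply' _ (N + 1), smul_eq_C_mul, mul_add, ← mul_assoc (C _) (C _),
        ← C_mul]
      have : c (N + 1) * (2 * ((N : ℝ) + 1) * (2 * N + d + 2 * ((n - 2 * (N + 1) : ℕ) : ℝ))) =
          - c N := by
        rw [← hc N hN', Nat.cast_sub hN']
        push_cast
        ring
      rw [this, C_neg]
      ring
  -- The surviving end term contains Δ of a polynomial of degree n - 2(n/2) < 2, hence is zero.
  rw [laplaceSeries, key _ le_rfl, Function.iterate_succ_apply',
    (hp.iterate_polyLaplacian (n / 2)).polyLaplacian_eq_zero (by omega)]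
  simp

theorem IsHomogeneous.laplaceSeries {p : MvPolynomial (Fin d) ℝ} {n : ℕ}
    (hp : p.IsHomogeneous n) (c : ℕ → ℝ) :
    (laplaceSeries c n p).IsHomogeneous n := by
  refine IsHomogeneous.sum _ _ _ fun j hj => IsHomogeneous.C_mul ?_ _
  have h := (isHomogeneous_normSqPoly.pow j).mul (hp.iterate_polyLaplacian j)
  rwa [show 2 * j + (n - 2 * j) = n by have := Finset.mem_range.1 hj; omega] at h

/-- Splits off the term j = 0. The clause for n < 2 is needed because n - 2 is then truncated and
the degree statement alone would allow a nonzero constant. -/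
theorem exists_laplaceSeries_eq {p : MvPolynomial (Fin d) ℝ} {n : ℕ}
    (hp : p.IsHomogeneous n) (c : ℕ → ℝ) :
    ∃ r : MvPolynomial (Fin d) ℝ, r.IsHomogeneous (n - 2) ∧ (n < 2 → r = 0) ∧
      MvPolynomial.laplaceSeries c n p = C (c 0) * p + normSqPoly d * r := by
  refine ⟨∑ j ∈ Finset.range (n / 2),
    C (c (j + 1)) * (normSqPoly d ^ j * (polyLaplacian d)^[j + 1] p), ?_, ?_, ?_⟩
  · refine IsHomogeneous.sum _ _ _ fun j hj => IsHomogeneous.C_mul ?_ _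
    have h := (isHomogeneous_normSqPoly.pow j).mul (hp.iterate_polyLaplacian (j + 1))
    rwa [show 2 * j + (n - 2 * (j + 1)) = n - 2 by have := Finset.mem_range.1 hj; omega] at h
  · intro hn
    rw [show n / 2 = 0 by omega, Finset.sum_range_zero]
  · rw [MvPolynomial.laplaceSeries, Finset.sum_range_succ', add_comm, Finset.mul_sum]
    congr 1
    · simp
    · refine Finset.sum_congr rfl fun j _ => ?_
      ring

theorem iterate_polyLaplacian_linearFormPoly_pow {ξ : EuclideanSpace ℝ (Fin d)} (hξ : ‖ξ‖ = 1)
    (n j : ℕ) : (polyLaplacian d)^[j] (linearFormPoly ξ ^ n) =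
      C ((n.descFactorial (2 * j) : ℕ) : ℝ) * linearFormPoly ξ ^ (n - 2 * j) := by
  have hs : ∑ i, (C (ξ i) : MvPolynomial (Fin d) ℝ) ^ 2 = 1 := by
    have h : ∑ i, ξ i ^ 2 = 1 := by
      rw [← EuclideanSpace.real_norm_sq_eq, hξ, one_pow]
    simp only [← map_pow, ← map_sum, h, map_one]
  have hl : ∀ m, polyLaplacian d (linearFormPoly ξ ^ m) =
      C (((m * (m - 1) : ℕ)) : ℝ) * linearFormPoly ξ ^ (m - 2) := by
    intro m
    have hi : ∀ i : Fin d, pderiv i (pderiv i (linearFormPoly ξ ^ m)) =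
        C (((m * (m - 1) : ℕ)) : ℝ) * linearFormPoly ξ ^ (m - 2) * C (ξ i) ^ 2 := by
      intro i
      rw [pderiv_pow, pderiv_linearFormPoly, mul_assoc, ← map_natCast C, pderiv_C_mul,
        mul_comm (_ ^ _), pderiv_C_mul, pderiv_pow, pderiv_linearFormPoly]
      push_cast
      rw [C_mul, map_natCast, map_natCast, Nat.sub_sub]
      ring
    rw [polyLaplacian_apply, Finset.sum_congr rfl fun i _ => hi i, ← Finset.mul_sum, hs, mul_one]
  induction j with
  | zero => simp
  | succ j ih =>
    have h1 : n.descFactorial (2 * j) * ((n - 2 * j) * (n - 2 * j - 1)) =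
        n.descFactorial (2 * (j + 1)) := by
      rw [show 2 * (j + 1) = 2 * j + 1 + 1 by ring, Nat.descFactorial_succ,
        Nat.descFactorial_succ, Nat.sub_sub]
      ring
    rw [Function.iterate_succ_apply', ih, ← smul_eq_C_mul, map_smul, hl, smul_eq_C_mul,
      ← mul_assoc, ← C_mul, ← Nat.cast_mul, h1, Nat.sub_sub, mul_add_one]

/-- The coefficients of the zonal harmonic of degree `n` as a Laplace series of `⟨ξ, x⟩ ^ n`. -/
def zonalCoeff (lam : ℝ) (n j : ℕ) : ℝ :=
  (-1) ^ j * (ascPochhammer ℝ (n - j)).eval lam * 2 ^ (n - 2 * j) /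
    ((Nat.factorial j : ℝ) * (Nat.factorial n : ℝ))

/-- The homogeneous harmonic polynomial of degree `n` that agrees with
`x ↦ C_n^{((d-2)/2)}(⟨ξ, x⟩)` on the unit sphere. -/
def zonalPoly (n : ℕ) (ξ : EuclideanSpace ℝ (Fin d)) : MvPolynomial (Fin d) ℝ :=
  laplaceSeries (zonalCoeff (((d : ℝ) - 2) / 2) n) n (linearFormPoly ξ ^ n)

theorem isHomogeneous_linearFormPoly_pow (ξ : EuclideanSpace ℝ (Fin d)) (n : ℕ) :
    (linearFormPoly ξ ^ n).IsHomogeneous n := by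
  simpa using (isHomogeneous_linearFormPoly ξ).pow n

theorem isHomogeneous_zonalPoly (n : ℕ) (ξ : EuclideanSpace ℝ (Fin d)) :
    (zonalPoly n ξ).IsHomogeneous n :=
  (isHomogeneous_linearFormPoly_pow ξ n).laplaceSeries _

/-- The Pochhammer factor lost from j to j+1 is (d-2)/2 + n-j-1 = (2n+d-4-2j)/2, which is exactly
the factor that harmonicity requires. -/
theorem zonalCoeff_succ {n j : ℕ} (h : 2 * (j + 1) ≤ n) :
    zonalCoeff (((d : ℝ) - 2) / 2) n (j + 1) * (2 * ((j : ℝ) + 1) * (2 * n + d - 4 - 2 * j)) =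
      -zonalCoeff (((d : ℝ) - 2) / 2) n j := by
  obtain ⟨m, rfl⟩ := Nat.exists_eq_add_of_le h
  unfold zonalCoeff
  rw [show 2 * (j + 1) + m - j = (2 * (j + 1) + m - (j + 1)) + 1 by omega,
    show 2 * (j + 1) + m - 2 * j = 2 * (j + 1) + m - 2 * (j + 1) + 2 by omega,
    ascPochhammer_succ_eval, show 2 * (j + 1) + m - (j + 1) = j + 1 + m by omega,
    Nat.factorial_succ]
  have h1 := Nat.factorial_ne_zero j
  have h2 := Nat.factorial_ne_zero (2 * (j + 1) + m)
  push_cast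
  field_simp
  ring

theorem polyLaplacian_zonalPoly (n : ℕ) (ξ : EuclideanSpace ℝ (Fin d)) :
    polyLaplacian d (zonalPoly n ξ) = 0 :=
  polyLaplacian_laplaceSeries (isHomogeneous_linearFormPoly_pow ξ n) fun _ => zonalCoeff_succ

theorem polyEval_normSqPoly (x : EuclideanSpace ℝ (Fin d)) :
    polyEval x (normSqPoly d) = ‖x‖ ^ 2 := by
  simp [polyEval, normSqPoly, EuclideanSpace.real_norm_sq_eq]

theorem polyEval_linearFormPoly (ξ x : EuclideanSpace ℝ (Fin d)) :
    polyEval x (linearFormPoly ξ) = inner ℝ ξ x := by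
  simp [polyEval, linearFormPoly, PiLp.inner_apply, mul_comm]

theorem polyEval_smul {p : MvPolynomial (Fin d) ℝ} {n : ℕ} (hp : p.IsHomogeneous n) (r : ℝ)
    (x : EuclideanSpace ℝ (Fin d)) : polyEval (r • x) p = r ^ n * polyEval x p := by
  simp only [polyEval, eval_eq, Finset.mul_sum]
  refine Finset.sum_congr rfl fun s hs => ?_
  have hs' : ∑ i, s i = n := by
    rw [← hp (mem_support_iff.1 hs)]
    simp [Finsupp.weight_apply, Finsupp.sum_fintype]
  have : ∏ i ∈ s.support, (r • x).ofLp i ^ s i = r ^ n * ∏ i ∈ s.support, x.ofLp i ^ s i := by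
    simp only [PiLp.smul_apply, smul_eq_mul, mul_pow, Finset.prod_mul_distrib,
      Finset.prod_pow_eq_pow_sum]
    rw [← hs', Finset.sum_subset (Finset.subset_univ _)]
    intro i _ hi
    simpa using hi
  rw [this]
  ring

/-- On the sphere |x|² = 1, and Δ^j ⟨ξ,x⟩^n = n!/(n-2j)! ⟨ξ,x⟩^(n-2j) for a unit vector ξ;
`zonalCoeff` is the Gegenbauer coefficient divided by this factor. -/
theorem polyEval_zonalPoly_of_norm_eq_one {ξ x : EuclideanSpace ℝ (Fin d)} (hξ : ‖ξ‖ = 1)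
    (hx : ‖x‖ = 1) (n : ℕ) :
    polyEval x (zonalPoly n ξ) = (gegenbauer n (((d : ℝ) - 2) / 2)).eval (inner ℝ ξ x) := by
  have hl := polyEval_linearFormPoly ξ x
  have hq := polyEval_normSqPoly x
  simp only [polyEval] at hl hq ⊢
  rw [zonalPoly, laplaceSeries, gegenbauer, map_sum, Polynomial.eval_finsetSum]
  refine Finset.sum_congr rfl fun j hj => ?_
  have hj' : 2 * j ≤ n := by have := Finset.mem_range.1 hj; omega
  rw [iterate_polyLaplacian_linearFormPoly_pow hξ]
  simp only [map_mul, eval_C, map_pow, hl, hq, hx, one_pow, one_mul, Polynomial.eval_mul,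
    Polynomial.eval_C, Polynomial.eval_pow, Polynomial.eval_X, Polynomial.eval_ofNat]
  have h1 := Nat.factorial_ne_zero j
  have h2 := Nat.factorial_ne_zero (n - 2 * j)
  have h3 : ((n - 2 * j).factorial : ℝ) * (n.descFactorial (2 * j) : ℝ) = n.factorial := by
    exact_mod_cast Nat.factorial_mul_descFactorial hj'
  have h4 := Nat.factorial_ne_zero n
  rw [zonalCoeff, mul_pow, ← h3]
  have h5 : (n.descFactorial (2 * j) : ℝ) ≠ 0 := by
    intro h0
    rw [h0, mul_zero] at h3
    exact h4 (by exact_mod_cast h3.symm)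
  field_simp

end MvPolynomial

end

/-! ### Integration of polynomials over the sphere. -/

noncomputable section

open MvPolynomial Set

variable {d : ℕ}

theorem differentiable_polyEval (p : MvPolynomial (Fin d) ℝ) :
    Differentiable ℝ fun x : EuclideanSpace ℝ (Fin d) => polyEval x p := by
  induction p using MvPolynomial.induction_on with
  | C a => simp [polyEval]
  | add p q hp hq =>
    simp only [polyEval, map_add] at hp hq ⊢
    fun_prop
  | mul_X p i hp =>
    simp only [polyEval, map_mul, eval_X] at hp ⊢
    fun_prop

theorem continuous_polyEval (p : MvPolynomial (Fin d) ℝ) :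
    Continuous fun x : EuclideanSpace ℝ (Fin d) => polyEval x p :=
  (differentiable_polyEval p).continuous

theorem fderiv_polyEval (p : MvPolynomial (Fin d) ℝ) (i : Fin d)
    (x : EuclideanSpace ℝ (Fin d)) :
    fderiv ℝ (fun x : EuclideanSpace ℝ (Fin d) => polyEval x p) x (EuclideanSpace.single i 1) =
      polyEval x (pderiv i p) := by
  induction p using MvPolynomial.induction_on with
  | C a => simp [polyEval]
  | add p q hp hq =>
    have : (fun x : EuclideanSpace ℝ (Fin d) => polyEval x (p + q)) =
      (fun x => polyEval x p) + fun x => polyEval x q := by ext; simp [polyEval]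
    rw [this, fderiv_add (differentiable_polyEval p x) (differentiable_polyEval q x)]
    rw [map_add, add_apply, hp, hq, polyEval, polyEval, polyEval, map_add]
  | mul_X p j hp =>
    have : (fun x : EuclideanSpace ℝ (Fin d) => polyEval x (p * X j)) =
      (fun x => polyEval x p) * fun x => EuclideanSpace.proj (𝕜 := ℝ) j x := by
      ext; simp [polyEval]
    rw [this, fderiv_mul (differentiable_polyEval p x) (by fun_prop)]
    simp only [add_apply, smul_apply, hp,
      ContinuousLinearMap.fderiv, smul_eq_mul]
    simp [polyEval, pderiv_X, Pi.single_apply, eq_comm, apply_ite (eval x.ofLp)]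

theorem exists_abs_polyEval_le {p : MvPolynomial (Fin d) ℝ} {n : ℕ} (hp : p.IsHomogeneous n) :
    ∃ C : ℝ, 0 ≤ C ∧ ∀ x : EuclideanSpace ℝ (Fin d), |polyEval x p| ≤ C * ‖x‖ ^ n := by
  refine ⟨∑ s ∈ p.support, |coeff s p|, Finset.sum_nonneg fun _ _ => abs_nonneg _, fun x => ?_⟩
  rw [polyEval, eval_eq, Finset.sum_mul]
  refine (Finset.abs_sum_le_sum_abs _ _).trans (Finset.sum_le_sum fun s hs => ?_)
  rw [abs_mul]
  refine mul_le_mul_of_nonneg_left ?_ (abs_nonneg _)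
  have hs' : ∑ i ∈ s.support, s i = n := by
    rw [← hp (mem_support_iff.1 hs)]
    simp [Finsupp.weight_apply, Finsupp.sum]
  rw [Finset.abs_prod, ← hs', ← Finset.prod_pow_eq_pow_sum]
  refine Finset.prod_le_prod (fun _ _ => abs_nonneg _) fun i _ => ?_
  rw [abs_pow]
  exact pow_le_pow_left₀ (abs_nonneg _) (PiLp.norm_apply_le x i) _

/-- Integration in polar coordinates of a product of an angular and a radial function. -/
theorem integral_angular_mul_radial [NeZero d] (F : EuclideanSpace ℝ (Fin d) → ℝ) (g : ℝ → ℝ) :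
    ∫ x : EuclideanSpace ℝ (Fin d), F (‖x‖⁻¹ • x) * g ‖x‖ =
      (∫ ξ : Metric.sphere (0 : EuclideanSpace ℝ (Fin d)) 1, F ξ
        ∂(volume : Measure (EuclideanSpace ℝ (Fin d))).toSphere) *
      ∫ r in Ioi (0 : ℝ), r ^ (d - 1) * g r := by
  set μ : Measure (EuclideanSpace ℝ (Fin d)) := volume
  have hfin : Module.finrank ℝ (EuclideanSpace ℝ (Fin d)) = d := by simp
  calc
    _ = ∫ x : ({(0)}ᶜ : Set (EuclideanSpace ℝ (Fin d))), F (‖x.1‖⁻¹ • x.1) * g ‖x.1‖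
        ∂(μ.comap (↑)) := by
      rw [integral_subtype_comap (measurableSet_singleton _).compl
        fun x : EuclideanSpace ℝ (Fin d) ↦ F (‖x‖⁻¹ • x) * g ‖x‖, restrict_compl_singleton]
    _ = ∫ z, F z.1 * g z.2 ∂μ.toSphere.prod (.volumeIoiPow (d - 1)) := by
      have := μ.measurePreserving_homeomorphUnitSphereProd.integral_comp
        (Homeomorph.measurableEmbedding _)
        (fun z : Metric.sphere (0 : EuclideanSpace ℝ (Fin d)) 1 × Ioi (0 : ℝ) => F z.1 * g z.2)
      rw [hfin] at this
      simpa using this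
    _ = (∫ ξ, F ξ ∂μ.toSphere) * ∫ r : Ioi (0 : ℝ), g r ∂.volumeIoiPow (d - 1) :=
      integral_prod_mul (fun ξ : Metric.sphere (0 : EuclideanSpace ℝ (Fin d)) 1 => F ξ)
        (fun r : Ioi (0 : ℝ) => g r)
    _ = _ := by
      congr 1
      simp only [Measure.volumeIoiPow, ENNReal.ofReal]
      rw [integral_withDensity_eq_integral_smul,
        integral_subtype_comap measurableSet_Ioi fun a ↦ Real.toNNReal (a ^ (d - 1)) • g a,
        setIntegral_congr_fun measurableSet_Ioi fun x hx ↦ ?_]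
      · rw [NNReal.smul_def, Real.coe_toNNReal _ (pow_nonneg hx.out.le _), smul_eq_mul]
      · exact (measurable_subtype_coe.pow_const _).real_toNNReal

theorem integrable_polyEval_sphere (p : MvPolynomial (Fin d) ℝ) :
    Integrable (fun ξ : Metric.sphere (0 : EuclideanSpace ℝ (Fin d)) 1 => polyEval ξ.1 p)
      (volume : Measure (EuclideanSpace ℝ (Fin d))).toSphere :=
  ((continuous_polyEval p).comp continuous_subtype_val).integrable_of_hasCompactSupport
    (HasCompactSupport.of_compactSpace _)

/-- The integral of a polynomial over the unit sphere. -/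
def sphereIntegral (d : ℕ) : MvPolynomial (Fin d) ℝ →ₗ[ℝ] ℝ where
  toFun p := ∫ ξ : Metric.sphere (0 : EuclideanSpace ℝ (Fin d)) 1, polyEval ξ.1 p
    ∂(volume : Measure (EuclideanSpace ℝ (Fin d))).toSphere
  map_add' p q := by
    rw [← integral_add (integrable_polyEval_sphere p) (integrable_polyEval_sphere q)]
    simp [polyEval]
  map_smul' c p := by
    simp [polyEval, smul_eval, integral_const_mul]

theorem sphereIntegral_apply (p : MvPolynomial (Fin d) ℝ) :
    sphereIntegral d p = ∫ ξ : Metric.sphere (0 : EuclideanSpace ℝ (Fin d)) 1, polyEval ξ.1 p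
      ∂(volume : Measure (EuclideanSpace ℝ (Fin d))).toSphere := rfl

theorem sphereIntegral_C (a : ℝ) : sphereIntegral d (C a) = a * sphereArea d := by
  rw [sphereIntegral_apply]
  simp only [polyEval, eval_C, integral_const, sphereArea, smul_eq_mul, Measure.real]
  ring

theorem sphereIntegral_normSqPoly_mul (p : MvPolynomial (Fin d) ℝ) :
    sphereIntegral d (normSqPoly d * p) = sphereIntegral d p := by
  simp only [sphereIntegral_apply]
  refine integral_congr_ae (.of_forall fun ξ => ?_)
  have h := polyEval_normSqPoly ξ.1
  simp only [polyEval, map_mul] at h ⊢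
  simp [h]

theorem sphereArea_pos [NeZero d] : 0 < sphereArea d := by
  refine ENNReal.toReal_pos ?_ (measure_ne_top _ _)
  rw [Measure.measure_univ_ne_zero]
  exact Measure.toSphere_ne_zero _

theorem polyEval_eq_norm_pow_mul {p : MvPolynomial (Fin d) ℝ} {n : ℕ} (hp : p.IsHomogeneous n)
    {x : EuclideanSpace ℝ (Fin d)} (hx : x ≠ 0) :
    polyEval x p = ‖x‖ ^ n * polyEval (‖x‖⁻¹ • x) p := by
  rw [← polyEval_smul hp, smul_inv_smul₀ (norm_ne_zero_iff.2 hx)]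

theorem ae_ne_zero [NeZero d] : ∀ᵐ x : EuclideanSpace ℝ (Fin d), x ≠ 0 :=
  compl_mem_ae_iff.2 (measure_singleton 0)

theorem integral_polyEval_mul_radial [NeZero d] {p : MvPolynomial (Fin d) ℝ} {n : ℕ}
    (hp : p.IsHomogeneous n) (g : ℝ → ℝ) :
    ∫ x : EuclideanSpace ℝ (Fin d), polyEval x p * g ‖x‖ =
      sphereIntegral d p * ∫ r in Ioi (0 : ℝ), r ^ (n + (d - 1)) * g r := by
  rw [integral_congr_ae (g := fun x => polyEval (‖x‖⁻¹ • x) p * (‖x‖ ^ n * g ‖x‖)),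
    integral_angular_mul_radial (fun x => polyEval x p) fun r => r ^ n * g r,
    sphereIntegral_apply]
  · congr 2
    ext r
    ring
  · filter_upwards [ae_ne_zero] with x hx
    rw [polyEval_eq_norm_pow_mul hp hx]
    ring

theorem integral_pow_mul_exp_neg_sq (n : ℕ) :
    ∫ r in Ioi (0 : ℝ), r ^ n * Real.exp (-r ^ 2) = 1 / 2 * Real.Gamma (((n : ℝ) + 1) / 2) := by
  have h := integral_rpow_mul_exp_neg_rpow (p := 2) (q := n) two_pos
    (by have : (0 : ℝ) ≤ n := n.cast_nonneg
        linarith)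
  simpa only [Real.rpow_natCast, Real.rpow_two] using h

theorem integrableOn_pow_mul_exp_neg_sq (n : ℕ) :
    IntegrableOn (fun r : ℝ => r ^ n * Real.exp (-r ^ 2)) (Ioi 0) := by
  have h := integrableOn_rpow_mul_exp_neg_mul_sq (b := 1) one_pos (s := n)
    (by have : (0 : ℝ) ≤ n := n.cast_nonneg
        linarith)
  simpa using h

theorem integrable_polyEval_mul_exp [NeZero d] {p : MvPolynomial (Fin d) ℝ} {n : ℕ}
    (hp : p.IsHomogeneous n) :
    Integrable fun x : EuclideanSpace ℝ (Fin d) => polyEval x p * Real.exp (-‖x‖ ^ 2) := by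
  obtain ⟨C, -, hC⟩ := exists_abs_polyEval_le hp
  have hi : Integrable fun x : EuclideanSpace ℝ (Fin d) => ‖x‖ ^ n * Real.exp (-‖x‖ ^ 2) := by
    rw [integrable_fun_norm_addHaar volume (f := fun r => r ^ n * Real.exp (-r ^ 2))]
    simp only [smul_eq_mul, ← mul_assoc, ← pow_add]
    exact integrableOn_pow_mul_exp_neg_sq _
  refine (hi.const_mul C).mono' ?_ (.of_forall fun x => ?_)
  · exact ((continuous_polyEval p).mul (by fun_prop)).aestronglyMeasurable
  · rw [Real.norm_eq_abs, abs_mul, abs_of_pos (Real.exp_pos _), ← mul_assoc]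
    exact mul_le_mul_of_nonneg_right (hC x) (Real.exp_pos _).le

/-- Integration by parts: ∂_i of the Gaussian is -2x_i times it. In polar coordinates both sides
become sphere integrals times Gamma values, which is how a surface identity comes out of a volume
integral. -/
theorem integral_pderiv_mul_exp [NeZero d] {p : MvPolynomial (Fin d) ℝ} {n : ℕ}
    (hp : p.IsHomogeneous n) (i : Fin d) :
    ∫ x : EuclideanSpace ℝ (Fin d), polyEval x (pderiv i p) * Real.exp (-‖x‖ ^ 2) =
      2 * ∫ x : EuclideanSpace ℝ (Fin d), polyEval x (X i * p) * Real.exp (-‖x‖ ^ 2) := by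
  have hw : ∀ x : EuclideanSpace ℝ (Fin d),
      HasFDerivAt (fun x : EuclideanSpace ℝ (Fin d) => Real.exp (-‖x‖ ^ 2))
        (Real.exp (-‖x‖ ^ 2) • -((2 : ℕ) • innerSL ℝ x : EuclideanSpace ℝ (Fin d) →L[ℝ] ℝ)) x := fun x =>
    ((hasStrictFDerivAt_norm_sq x).hasFDerivAt.neg).exp
  have hw' : ∀ x : EuclideanSpace ℝ (Fin d), polyEval x p *
      fderiv ℝ (fun x : EuclideanSpace ℝ (Fin d) => Real.exp (-‖x‖ ^ 2)) x
        (EuclideanSpace.single i 1) = -2 * (polyEval x (X i * p) * Real.exp (-‖x‖ ^ 2)) := by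
    intro x
    rw [(hw x).fderiv]
    simp [polyEval, EuclideanSpace.inner_single_right]
    ring
  have h := integral_mul_fderiv_eq_neg_fderiv_mul_of_integrable (μ := volume)
    (f := fun x : EuclideanSpace ℝ (Fin d) => polyEval x p)
    (g := fun x : EuclideanSpace ℝ (Fin d) => Real.exp (-‖x‖ ^ 2))
    (v := EuclideanSpace.single i 1)
    (by simpa only [fderiv_polyEval] using integrable_polyEval_mul_exp hp.pderiv)
    (by simpa only [hw'] using
      (integrable_polyEval_mul_exp ((isHomogeneous_X ℝ i).mul hp)).const_mul (-2))
    (integrable_polyEval_mul_exp hp) (fun x _ => differentiable_polyEval p x)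
    (fun x _ => (hw x).differentiableAt)
  simp only [hw', fderiv_polyEval, integral_const_mul] at h
  linarith

/-- The divergence theorem on the sphere, for polynomials. -/
theorem sphereIntegral_pderiv [NeZero d] {p : MvPolynomial (Fin d) ℝ} {n : ℕ}
    (hd : 2 ≤ d) (hp : p.IsHomogeneous n) (i : Fin d) :
    sphereIntegral d (pderiv i p) = ((n : ℝ) + d - 1) * sphereIntegral d (X i * p) := by
  have h := integral_pderiv_mul_exp hp i
  rw [integral_polyEval_mul_radial hp.pderiv fun r => Real.exp (-r ^ 2),
    integral_polyEval_mul_radial ((isHomogeneous_X ℝ i).mul hp) fun r => Real.exp (-r ^ 2),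
    integral_pow_mul_exp_neg_sq, integral_pow_mul_exp_neg_sq] at h
  have hG : Real.Gamma (((n : ℝ) + d - 1) / 2) ≠ 0 := by
    refine (Real.Gamma_pos_of_pos ?_).ne'
    have : (2 : ℝ) ≤ d := by exact_mod_cast hd
    have : (0 : ℝ) ≤ n := n.cast_nonneg
    linarith
  have e1 : ((1 + n + (d - 1) : ℕ) : ℝ) + 1 = (n : ℝ) + d - 1 + 2 := by
    rw [Nat.cast_add, Nat.cast_sub (by omega)]
    push_cast
    ring
  -- For n = 0 the truncated n - 1 gives the wrong Gamma argument, but then the derivative is zero.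
  have e2 : sphereIntegral d (pderiv i p) * (1 / 2 * Real.Gamma (((n - 1 + (d - 1) : ℕ) + 1) / 2)) =
      sphereIntegral d (pderiv i p) * (1 / 2 * Real.Gamma (((n : ℝ) + d - 1) / 2)) := by
    rcases Nat.eq_zero_or_pos n with rfl | hn
    · simp [hp.pderiv_eq_zero]
    · rw [Nat.cast_add, Nat.cast_sub hn, Nat.cast_sub (by omega : 1 ≤ d)]
      push_cast
      ring_nf
  have e3 : Real.Gamma (((n : ℝ) + d - 1 + 2) / 2) =
      ((n : ℝ) + d - 1) / 2 * Real.Gamma (((n : ℝ) + d - 1) / 2) := by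
    rw [← Real.Gamma_add_one]
    · congr 1
      ring
    -- `Real.Gamma` takes the value 0 at 0, so `hG` rules this case out.
    · intro h0
      rw [h0] at hG
      simp at hG
  rw [e1, e2, e3] at h
  apply mul_right_cancel₀ hG
  linarith

end

/-! ### Orthogonality and reproducing property of spherical harmonics. -/

noncomputable section

open MvPolynomial Set

variable {d : ℕ}

/-- Green's identity: apply `sphereIntegral_pderiv` to p ∂_i h, of degree n+l-1, and sum over i.
Euler's identity gives the factor l, and Δh = 0 removes the second-order term. -/
theorem sphereIntegral_mul_harmonic [NeZero d] (hd : 2 ≤ d) {p h : MvPolynomial (Fin d) ℝ}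
    {n l : ℕ} (hp : p.IsHomogeneous n) (hh : h.IsHomogeneous l) (hΔ : polyLaplacian d h = 0) :
    ((n : ℝ) + l + d - 2) * l * sphereIntegral d (p * h) =
      ∑ i, sphereIntegral d (pderiv i p * pderiv i h) := by
  rcases Nat.eq_zero_or_pos l with rfl | hl
  · simp [hh.pderiv_eq_zero]
  have h1 : ∀ i, sphereIntegral d (pderiv i (p * pderiv i h)) =
      ((n : ℝ) + l + d - 2) * sphereIntegral d (p * (X i * pderiv i h)) := by
    intro i
    rw [sphereIntegral_pderiv hd (hp.mul hh.pderiv) i, Nat.cast_add, Nat.cast_sub hl]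
    congr 1
    · push_cast
      ring
    · congr 1
      ring
  have h2 : ∑ i, sphereIntegral d (pderiv i (p * pderiv i h)) =
      ∑ i, sphereIntegral d (pderiv i p * pderiv i h) := by
    rw [← map_sum, ← map_sum]
    simp only [pderiv_mul, Finset.sum_add_distrib, ← Finset.mul_sum, ← polyLaplacian_apply, hΔ,
      mul_zero, add_zero]
  rw [← h2, Finset.sum_congr rfl fun i _ => h1 i, ← Finset.mul_sum, ← map_sum, ← Finset.mul_sum,
    hh.sum_X_mul_pderiv, mul_assoc, mul_smul_comm, map_nsmul, nsmul_eq_mul]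

/-- By Green's identity the integral reduces to those of ∂_i p ∂_i h, again a pair with harmonic
second factor and the same gap in degrees; at n = 0 the gradient of p vanishes. -/
theorem sphereIntegral_mul_harmonic_eq_zero [NeZero d] (hd : 2 ≤ d)
    {p h : MvPolynomial (Fin d) ℝ} {n l : ℕ} (hp : p.IsHomogeneous n) (hh : h.IsHomogeneous l)
    (hΔ : polyLaplacian d h = 0) (hnl : n < l) : sphereIntegral d (p * h) = 0 := by
  induction n generalizing l p h with
  | zero =>
    have := sphereIntegral_mul_harmonic hd hp hh hΔ
    simp only [hp.pderiv_eq_zero, zero_mul, map_zero, Finset.sum_const_zero, mul_eq_zero] at this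
    rcases this with (h1 | h1) | h1
    · have h2 : (2 : ℝ) ≤ d := by exact_mod_cast hd
      have h3 : (0 : ℝ) < l := by exact_mod_cast hnl
      push_cast at h1
      linarith
    · have h3 : (0 : ℝ) < l := by exact_mod_cast hnl
      linarith
    · exact h1
  | succ n ih =>
    have := sphereIntegral_mul_harmonic hd hp hh hΔ
    rw [Finset.sum_eq_zero fun i _ => ih (l := l - 1) hp.pderiv hh.pderiv
      (by rw [polyLaplacian_comm_pderiv, hΔ, map_zero]) (by omega)] at this
    have h2 : (2 : ℝ) ≤ d := by exact_mod_cast hd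
    have h3 : (0 : ℝ) < l := by exact_mod_cast (by omega : 0 < l)
    have h4 : (0 : ℝ) < ((n + 1 : ℕ) : ℝ) := by positivity
    have h5 : (((n + 1 : ℕ) : ℝ) + l + d - 2) * l ≠ 0 :=
      (mul_pos (by linarith) h3).ne'
    exact (mul_eq_zero.1 this).resolve_left h5

/-- The gradient of ⟨ξ,x⟩^(l+1) is (l+1)⟨ξ,x⟩^l ξ, so Green's identity replaces h by its derivative
along ξ. That derivative is harmonic of degree l, and its value at ξ is (l+1)h(ξ) by Euler's
identity. -/
theorem sphereIntegral_linearFormPoly_pow_mul_harmonic [NeZero d] (hd : 2 ≤ d)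
    (ξ : EuclideanSpace ℝ (Fin d)) {h : MvPolynomial (Fin d) ℝ} {l : ℕ}
    (hh : h.IsHomogeneous l) (hΔ : polyLaplacian d h = 0) :
    (∏ i ∈ Finset.range l, (2 * (i : ℝ) + d)) * sphereIntegral d (linearFormPoly ξ ^ l * h) =
      (l.factorial : ℝ) * sphereArea d * polyEval ξ h := by
  induction l generalizing h with
  | zero =>
    rw [totalDegree_eq_zero_iff_eq_C.1 ((totalDegree_zero_iff_isHomogeneous _).2 hh)]
    simp [sphereIntegral_C, polyEval, mul_comm]
  | succ l ih =>
    set D : MvPolynomial (Fin d) ℝ := ∑ i, C (ξ i) * pderiv i h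
    have hD : D.IsHomogeneous l := IsHomogeneous.sum _ _ _ fun i _ => hh.pderiv.C_mul _
    have hDΔ : polyLaplacian d D = 0 := by
      rw [map_sum]
      refine Finset.sum_eq_zero fun i _ => ?_
      rw [← smul_eq_C_mul, map_smul, polyLaplacian_comm_pderiv, hΔ, map_zero, smul_zero]
    have hDξ : polyEval ξ D = ((l : ℝ) + 1) * polyEval ξ h := by
      have := congrArg (polyEval ξ) hh.sum_X_mul_pderiv
      simpa [polyEval, D] using this
    have hg := sphereIntegral_mul_harmonic hd (isHomogeneous_linearFormPoly_pow ξ (l + 1)) hh hΔ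
    have hs : ∑ i, sphereIntegral d (pderiv i (linearFormPoly ξ ^ (l + 1)) * pderiv i h) =
        ((l : ℝ) + 1) * sphereIntegral d (linearFormPoly ξ ^ l * D) := by
      rw [← map_sum, ← smul_eq_mul, ← map_smul, smul_eq_C_mul]
      congr 1
      simp only [D, Finset.mul_sum]
      refine Finset.sum_congr rfl fun i _ => ?_
      rw [pderiv_pow, pderiv_linearFormPoly]
      simp only [Nat.add_sub_cancel, Nat.cast_add, Nat.cast_one, map_add, map_natCast, map_one]
      ring
    have hi := ih hD hDΔ
    rw [hs] at hg
    have hg' : (2 * (l : ℝ) + d) * sphereIntegral d (linearFormPoly ξ ^ (l + 1) * h) =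
        sphereIntegral d (linearFormPoly ξ ^ l * D) := by
      have h0 : (l : ℝ) + 1 ≠ 0 := by positivity
      apply mul_left_cancel₀ h0
      rw [← hg]
      push_cast
      ring
    rw [Finset.prod_range_succ, mul_assoc, hg', hi, hDξ, Nat.factorial_succ]
    push_cast
    ring

/-- Both sides are the product of d-2+2i over i = 0, …, l; the product on the right starts at i = 1,
so it needs the extra factor d-2. -/
theorem two_pow_mul_eval_ascPochhammer (d l : ℕ) :
    2 ^ l * (ascPochhammer ℝ l).eval (((d : ℝ) - 2) / 2) * (2 * l + d - 2) =
      (∏ i ∈ Finset.range l, (2 * (i : ℝ) + d)) * (d - 2) := by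
  induction l with
  | zero => simp
  | succ l ih =>
    rw [Finset.prod_range_succ, ascPochhammer_succ_eval]
    push_cast
    linear_combination (2 * (l : ℝ) + d) * ih

/-- The reproducing property of zonal harmonics. -/
theorem sphereIntegral_harmonic_mul_zonalPoly [NeZero d] (hd : 2 ≤ d)
    (ξ : EuclideanSpace ℝ (Fin d)) {h : MvPolynomial (Fin d) ℝ} {l : ℕ}
    (hh : h.IsHomogeneous l) (hΔ : polyLaplacian d h = 0) :
    (2 * (l : ℝ) + d - 2) * sphereIntegral d (h * zonalPoly l ξ) =
      ((d : ℝ) - 2) * sphereArea d * polyEval ξ h := by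
  obtain ⟨r, hr, hr0, hz⟩ := exists_laplaceSeries_eq (isHomogeneous_linearFormPoly_pow ξ l)
    (zonalCoeff (((d : ℝ) - 2) / 2) l)
  -- The zonal polynomial differs from a multiple of ⟨ξ,x⟩^l by |x|² r, and r has too low a degree
  -- to see h.
  have hrh : sphereIntegral d (r * h) = 0 := by
    rcases lt_or_ge l 2 with h2 | h2
    · simp [hr0 h2]
    · exact sphereIntegral_mul_harmonic_eq_zero hd hr hh hΔ (by omega)
  have hS : sphereIntegral d (h * zonalPoly l ξ) =
      zonalCoeff (((d : ℝ) - 2) / 2) l 0 * sphereIntegral d (linearFormPoly ξ ^ l * h) := by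
    have : h * zonalPoly l ξ = zonalCoeff (((d : ℝ) - 2) / 2) l 0 • (linearFormPoly ξ ^ l * h) +
        normSqPoly d * (r * h) := by
      rw [zonalPoly, hz, smul_eq_C_mul]
      ring
    rw [this, map_add, sphereIntegral_normSqPoly_mul, hrh, map_smul, smul_eq_mul, add_zero]
  have h1 := sphereIntegral_linearFormPoly_pow_mul_harmonic hd ξ hh hΔ
  have h2 := two_pow_mul_eval_ascPochhammer d l
  have h3 : (l.factorial : ℝ) ≠ 0 := by positivity
  rw [hS, zonalCoeff]
  simp only [pow_zero, Nat.sub_zero, mul_zero, Nat.factorial_zero, Nat.cast_one, one_mul]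
  apply mul_left_cancel₀ h3
  field_simp
  linear_combination sphereIntegral d (linearFormPoly ξ ^ l * h) * h2 + ((d : ℝ) - 2) * h1

/-- Solving the recursion for a harmonic Laplace series with c_0 = 1 changes p only by a multiple of
|x|². -/
theorem exists_harmonic_add_normSqPoly_mul (hd : 2 ≤ d) {p : MvPolynomial (Fin d) ℝ} {n : ℕ}
    (hp : p.IsHomogeneous n) :
    ∃ h r : MvPolynomial (Fin d) ℝ, h.IsHomogeneous n ∧ polyLaplacian d h = 0 ∧
      r.IsHomogeneous (n - 2) ∧ (n < 2 → r = 0) ∧ p = h + normSqPoly d * r := by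
  let c : ℕ → ℝ := fun j => Nat.rec 1
    (fun j c => -c / (2 * ((j : ℝ) + 1) * (2 * n + d - 4 - 2 * j))) j
  have hc : ∀ j, 2 * (j + 1) ≤ n →
      c (j + 1) * (2 * ((j : ℝ) + 1) * (2 * n + d - 4 - 2 * j)) = -c j := by
    intro j hj
    have h1 : (2 : ℝ) ≤ d := by exact_mod_cast hd
    have h2 : 2 * ((j : ℝ) + 1) ≤ n := by exact_mod_cast hj
    have h3 : (0 : ℝ) ≤ j := j.cast_nonneg
    -- The denominators of the recursion stay positive in the range 2(j+1) ≤ n because d ≥ 2.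
    have h4 : 0 < 2 * ((j : ℝ) + 1) * (2 * n + d - 4 - 2 * j) :=
      mul_pos (by linarith) (by linarith)
    exact div_mul_cancel₀ _ h4.ne'
  obtain ⟨r, hr, hr0, hz⟩ := exists_laplaceSeries_eq hp c
  refine ⟨laplaceSeries c n p, -r, hp.laplaceSeries c, polyLaplacian_laplaceSeries hp hc,
    hr.neg, fun h => by rw [hr0 h, neg_zero], ?_⟩
  rw [hz]
  simp [c]

/-- The zonal harmonics of even degree at most `2m` reproduce homogeneous polynomials of
degree `2m` on the unit sphere. -/
theorem sum_sphereIntegral_mul_zonalPoly [NeZero d] (hd : 2 ≤ d)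
    {ξ : EuclideanSpace ℝ (Fin d)} (hξ : ‖ξ‖ = 1) {p : MvPolynomial (Fin d) ℝ} {m : ℕ}
    (hp : p.IsHomogeneous (2 * m)) :
    ∑ i ∈ Finset.range (m + 1),
        ((d : ℝ) + 4 * i - 2) * sphereIntegral d (p * zonalPoly (2 * i) ξ) =
      ((d : ℝ) - 2) * sphereArea d * polyEval ξ p := by
  induction m generalizing p with
  | zero =>
    have := sphereIntegral_harmonic_mul_zonalPoly hd ξ hp (hp.polyLaplacian_eq_zero (by norm_num))
    rw [Finset.sum_range_one, ← this]
    push_cast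
    ring_nf
  | succ m ih =>
    -- On the sphere p = h + r. Zonal harmonics of degree at most 2m see only r (induction), and the
    -- top one sees only h (reproducing property).
    obtain ⟨h, r, hh, hΔ, hr, -, rfl⟩ := exists_harmonic_add_normSqPoly_mul hd hp
    have hsplit : ∀ q, sphereIntegral d ((h + normSqPoly d * r) * q) =
        sphereIntegral d (h * q) + sphereIntegral d (r * q) := by
      intro q
      rw [add_mul, map_add, mul_assoc, sphereIntegral_normSqPoly_mul]
    have hr' : r.IsHomogeneous (2 * m) := hr
    have hlow : ∀ i ∈ Finset.range (m + 1), ((d : ℝ) + 4 * i - 2) *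
        sphereIntegral d ((h + normSqPoly d * r) * zonalPoly (2 * i) ξ) =
        ((d : ℝ) + 4 * i - 2) * sphereIntegral d (r * zonalPoly (2 * i) ξ) := by
      intro i hi
      have := Finset.mem_range.1 hi
      rw [hsplit, mul_comm h, sphereIntegral_mul_harmonic_eq_zero hd
        (isHomogeneous_zonalPoly (2 * i) ξ) hh hΔ (by omega), zero_add]
    have htop := sphereIntegral_harmonic_mul_zonalPoly hd ξ hh hΔ
    have hev : polyEval ξ (h + normSqPoly d * r) = polyEval ξ h + polyEval ξ r := by
      have hq := polyEval_normSqPoly ξ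
      simp only [polyEval, map_add, map_mul] at hq ⊢
      rw [hq, hξ]
      ring
    rw [Finset.sum_range_succ, Finset.sum_congr rfl hlow, ih hr', hsplit,
      sphereIntegral_mul_harmonic_eq_zero hd hr' (isHomogeneous_zonalPoly _ ξ)
        (polyLaplacian_zonalPoly _ ξ) (by omega), hev]
    push_cast at htop ⊢
    linear_combination htop

end

/-! ### Chebyshev polynomials and the radial integral. -/

noncomputable section

open Set

/-- At parameter 1 the Pochhammer symbol is (l-j)!, so the coefficients are binomials. They vanish
for 2j > l, and summing over the whole antidiagonal makes Pascal's rule applicable without boundary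
cases. -/
theorem gegenbauer_one_eq_sum_antidiagonal (l : ℕ) :
    gegenbauer l 1 = ∑ p ∈ Finset.HasAntidiagonal.antidiagonal l,
      Polynomial.C ((-1) ^ p.2 * (p.1.choose p.2 : ℝ)) * (2 * Polynomial.X) ^ (p.1 - p.2) := by
  rw [Finset.Nat.sum_antidiagonal_eq_sum_range_succ_mk, ← Finset.sum_range_reflect, gegenbauer]
  simp only [Nat.succ_sub_one]
  rw [← Finset.sum_subset (Finset.range_mono (by omega : l / 2 + 1 ≤ l + 1))]
  · refine Finset.sum_congr rfl fun j hj => ?_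
    have hj' : 2 * j ≤ l := by have := Finset.mem_range.1 hj; omega
    rw [show l - (l - j) = j by omega, show l - j - j = l - 2 * j by omega, ascPochhammer_eval_one,
      Nat.cast_choose ℝ (by omega : j ≤ l - j), show l - j - j = l - 2 * j by omega, mul_div_assoc]
  · intro j hj hj'
    rw [Finset.mem_range] at hj hj'
    rw [Nat.choose_eq_zero_of_lt (by omega)]
    simp

theorem gegenbauer_one_add_two (l : ℕ) :
    gegenbauer (l + 2) 1 = 2 * Polynomial.X * gegenbauer (l + 1) 1 - gegenbauer l 1 := by
  -- Pascal's rule, term by term; for a ≤ j the truncated exponents agree and one binomial is zero.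
  have hT : ∀ a j : ℕ, Polynomial.C ((-1) ^ (j + 1) * ((a + 1).choose (j + 1) : ℝ)) *
      (2 * Polynomial.X) ^ (a + 1 - (j + 1)) =
      2 * Polynomial.X * (Polynomial.C ((-1) ^ (j + 1) * (a.choose (j + 1) : ℝ)) *
        (2 * Polynomial.X) ^ (a - (j + 1))) -
      Polynomial.C ((-1) ^ j * (a.choose j : ℝ)) * (2 * Polynomial.X) ^ (a - j) := by
    intro a j
    rw [Nat.choose_succ_succ, Nat.add_sub_add_right]
    rcases lt_or_ge a (j + 1) with h | h
    · rw [Nat.choose_eq_zero_of_lt h]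
      simp [pow_succ]
    · rw [show a - j = a - (j + 1) + 1 by omega]
      push_cast
      simp only [map_mul, map_add, map_pow, map_neg, map_one]
      ring
  simp only [gegenbauer_one_eq_sum_antidiagonal]
  rw [Finset.Nat.sum_antidiagonal_succ, Finset.Nat.sum_antidiagonal_succ',
    Finset.Nat.sum_antidiagonal_succ', Finset.sum_congr rfl fun p _ => hT p.1 p.2,
    Finset.sum_sub_distrib, ← Finset.mul_sum]
  simp
  ring

theorem gegenbauer_one_eq_U (l : ℕ) : gegenbauer l 1 = Polynomial.Chebyshev.U ℝ l := by
  induction l using Nat.twoStepInduction with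
  | zero => simp [gegenbauer_one_eq_sum_antidiagonal]
  | one => simp [gegenbauer_one_eq_sum_antidiagonal, Finset.Nat.antidiagonal_succ]
  | more l h0 h1 =>
    rw [gegenbauer_one_add_two, h0, h1]
    push_cast
    rw [Polynomial.Chebyshev.U_add_two]

/-- The substitution `r = 1 / cos θ`. -/
theorem integral_Ioi_inv_mul_sqrt (f : ℝ → ℝ) :
    ∫ r in Ioi (1 : ℝ), f (1 / r) * (Real.sqrt (r ^ 2 - 1) / r ^ 3) =
      ∫ θ in Ioo 0 (Real.pi / 2), f (Real.cos θ) * Real.sin θ ^ 2 := by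
  have hcos : ∀ θ ∈ Ioo 0 (Real.pi / 2), 0 < Real.cos θ := fun θ hθ =>
    Real.cos_pos_of_mem_Ioo ⟨by linarith [hθ.1, Real.pi_pos], hθ.2⟩
  have hsin : ∀ θ ∈ Ioo 0 (Real.pi / 2), 0 < Real.sin θ := fun θ hθ =>
    Real.sin_pos_of_pos_of_lt_pi hθ.1 (by linarith [hθ.2, Real.pi_pos])
  have himage : (fun θ => (Real.cos θ)⁻¹) '' Ioo 0 (Real.pi / 2) = Ioi 1 := by
    ext r
    constructor
    · rintro ⟨θ, hθ, rfl⟩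
      refine (one_lt_inv₀ (hcos θ hθ)).2 ?_
      have h1 := hsin θ hθ
      nlinarith [Real.sin_sq_add_cos_sq θ, hcos θ hθ]
    · intro hr
      have hr0 : (0 : ℝ) < r := zero_lt_one.trans hr
      have h1 : r⁻¹ < 1 := inv_lt_one_of_one_lt₀ hr
      refine ⟨Real.arccos r⁻¹, ⟨Real.arccos_pos.2 h1, Real.arccos_lt_pi_div_two.2 (by positivity)⟩, ?_⟩
      simp only
      rw [Real.cos_arccos (by linarith [inv_pos.2 hr0]) h1.le, inv_inv]
  have hderiv : ∀ θ ∈ Ioo 0 (Real.pi / 2), HasDerivWithinAt (fun θ => (Real.cos θ)⁻¹)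
      (Real.sin θ / Real.cos θ ^ 2) (Ioo 0 (Real.pi / 2)) θ := by
    intro θ hθ
    have := (Real.hasDerivAt_cos θ).inv (hcos θ hθ).ne'
    rw [neg_neg] at this
    exact this.hasDerivWithinAt
  have hinj : InjOn (fun θ => (Real.cos θ)⁻¹) (Ioo 0 (Real.pi / 2)) := by
    intro a ha b hb hab
    exact Real.injOn_cos ⟨ha.1.le, by linarith [ha.2, Real.pi_pos]⟩
      ⟨hb.1.le, by linarith [hb.2, Real.pi_pos]⟩ (inv_injective hab)
  rw [← himage, integral_image_eq_integral_abs_deriv_smul measurableSet_Ioo hderiv hinj]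
  refine setIntegral_congr_fun measurableSet_Ioo fun θ hθ => ?_
  have hc := hcos θ hθ
  have hs := hsin θ hθ
  have hsq : Real.sqrt ((Real.cos θ)⁻¹ ^ 2 - 1) = Real.sin θ / Real.cos θ := by
    rw [show (Real.cos θ)⁻¹ ^ 2 - 1 = (Real.sin θ / Real.cos θ) ^ 2 by
      field_simp
      linarith [Real.sin_sq_add_cos_sq θ]]
    exact Real.sqrt_sq (by positivity)
  simp only [smul_eq_mul]
  rw [hsq, abs_of_pos (by positivity), one_div, inv_inv]
  field_simp

/-- The pairing of functions on `[0, 1]` with respect to `√(1 - t²) dt`, with `t = cos θ`. -/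
def semicirclePairing (f g : Polynomial ℝ) : ℝ :=
  ∫ θ in (0 : ℝ)..(Real.pi / 2), f.eval (Real.cos θ) * g.eval (Real.cos θ) * Real.sin θ ^ 2

theorem semicirclePairing_add_left (f g h : Polynomial ℝ) :
    semicirclePairing (f + g) h = semicirclePairing f h + semicirclePairing g h := by
  unfold semicirclePairing
  rw [← intervalIntegral.integral_add]
  · simp [add_mul]
  all_goals exact (by fun_prop : Continuous _).intervalIntegrable _ _

theorem semicirclePairing_smul_left (a : ℝ) (f h : Polynomial ℝ) :
    semicirclePairing (a • f) h = a * semicirclePairing f h := by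
  unfold semicirclePairing
  rw [← intervalIntegral.integral_const_mul]
  simp [mul_assoc]

theorem integral_cos_two_mul_nat (n : ℤ) (hn : n ≠ 0) :
    ∫ θ in (0 : ℝ)..(Real.pi / 2), Real.cos (2 * n * θ) = 0 := by
  have h : (2 * (n : ℝ)) ≠ 0 := by positivity
  rw [intervalIntegral.integral_comp_mul_left _ h, integral_cos]
  rw [show 2 * (n : ℝ) * (Real.pi / 2) = n * Real.pi by ring, Real.sin_int_mul_pi]
  simp

/-- Since U_n(cos θ) sin θ = sin((n+1)θ), the integrand is a difference of cosines of even multiples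
of θ. Evenness of the degrees is what makes these integrate to zero already over [0, π/2]. -/
theorem semicirclePairing_U (i j : ℕ) :
    semicirclePairing (Polynomial.Chebyshev.U ℝ (2 * i)) (Polynomial.Chebyshev.U ℝ (2 * j)) =
      if i = j then Real.pi / 4 else 0 := by
  have h : ∀ θ : ℝ, (Polynomial.Chebyshev.U ℝ (2 * i)).eval (Real.cos θ) *
      (Polynomial.Chebyshev.U ℝ (2 * j)).eval (Real.cos θ) * Real.sin θ ^ 2 =
      (Real.cos (2 * ((i - j : ℤ) : ℝ) * θ) - Real.cos (2 * ((i + j + 1 : ℤ) : ℝ) * θ)) / 2 := by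
    intro θ
    have h1 := Polynomial.Chebyshev.U_real_cos θ (2 * i)
    have h2 := Polynomial.Chebyshev.U_real_cos θ (2 * j)
    have h3 := Real.cos_sub ((((2 * i : ℤ) : ℝ) + 1) * θ) ((((2 * j : ℤ) : ℝ) + 1) * θ)
    have h4 := Real.cos_add ((((2 * i : ℤ) : ℝ) + 1) * θ) ((((2 * j : ℤ) : ℝ) + 1) * θ)
    rw [← h1, ← h2] at h3 h4
    rw [show 2 * ((i - j : ℤ) : ℝ) * θ =
        (((2 * i : ℤ) : ℝ) + 1) * θ - (((2 * j : ℤ) : ℝ) + 1) * θ by push_cast; ring,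
      show 2 * ((i + j + 1 : ℤ) : ℝ) * θ =
        (((2 * i : ℤ) : ℝ) + 1) * θ + (((2 * j : ℤ) : ℝ) + 1) * θ by push_cast; ring, h3, h4]
    ring
  unfold semicirclePairing
  simp only [h]
  rw [intervalIntegral.integral_div, intervalIntegral.integral_sub
    ((by fun_prop : Continuous _).intervalIntegrable _ _)
    ((by fun_prop : Continuous _).intervalIntegrable _ _),
    integral_cos_two_mul_nat (i + j + 1) (by omega)]
  split_ifs with hij
  · subst hij
    simp
    ring
  · rw [integral_cos_two_mul_nat _ (by omega)]
    simp

/-- The three-term recurrence used twice. Integer indices let it cover j = 0. -/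
theorem X_sq_mul_U_two_mul (j : ℤ) : (Polynomial.X ^ 2 * Polynomial.Chebyshev.U ℝ (2 * j)) =
    (1 / 4 : ℝ) • (Polynomial.Chebyshev.U ℝ (2 * (j + 1)) +
      2 * Polynomial.Chebyshev.U ℝ (2 * j) + Polynomial.Chebyshev.U ℝ (2 * (j - 1))) := by
  have h1 := Polynomial.Chebyshev.U_add_one ℝ (2 * j + 1)
  have h2 := Polynomial.Chebyshev.U_add_one ℝ (2 * j)
  have h3 := Polynomial.Chebyshev.U_sub_one ℝ (2 * j - 1)
  rw [show 2 * j + 1 + 1 = 2 * (j + 1) by ring, show 2 * j + 1 - 1 = 2 * j by ring] at h1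
  rw [show 2 * j - 1 - 1 = 2 * (j - 1) by ring, show 2 * j - 1 + 1 = 2 * j by ring] at h3
  rw [h1, h3, h2, Polynomial.smul_eq_C_mul]
  have h4 : (Polynomial.C (1 / 4) : Polynomial ℝ) * 4 = 1 := by
    rw [show (4 : Polynomial ℝ) = Polynomial.C 4 from rfl, ← Polynomial.C_mul]
    norm_num
  linear_combination (-(Polynomial.X ^ 2 * Polynomial.Chebyshev.U ℝ (2 * j))) * h4

/-- The span of the Chebyshev polynomials of the second kind of even degree at most `2N`. -/
def evenChebyshevSpan (N : ℕ) : Submodule ℝ (Polynomial ℝ) :=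
  Submodule.span ℝ ((fun j : ℕ => Polynomial.Chebyshev.U ℝ (2 * j)) '' Iic N)

theorem U_mem_evenChebyshevSpan {j N : ℕ} (h : j ≤ N) :
    Polynomial.Chebyshev.U ℝ (2 * j) ∈ evenChebyshevSpan N :=
  Submodule.subset_span ⟨j, h, rfl⟩

theorem X_sq_mul_mem_evenChebyshevSpan {N : ℕ} {f : Polynomial ℝ} (hf : f ∈ evenChebyshevSpan N) :
    Polynomial.X ^ 2 * f ∈ evenChebyshevSpan (N + 1) := by
  unfold evenChebyshevSpan at hf
  induction hf using Submodule.span_induction with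
  | mem f hf =>
    obtain ⟨j, hj, rfl⟩ := hf
    have hj' : j ≤ N := hj
    simp only [X_sq_mul_U_two_mul, two_mul (Polynomial.Chebyshev.U ℝ _)]
    refine Submodule.smul_mem _ _ (Submodule.add_mem _ (Submodule.add_mem _ ?_
      (Submodule.add_mem _ ?_ ?_)) ?_)
    · exact_mod_cast U_mem_evenChebyshevSpan (j := j + 1) (by omega)
    · exact U_mem_evenChebyshevSpan (by omega)
    · exact U_mem_evenChebyshevSpan (by omega)
    · cases j with
      -- Here the lowest term is U_{-2} = -U_0.
      | zero =>
        have := Submodule.neg_mem _ (U_mem_evenChebyshevSpan (j := 0) (N := N + 1) (by omega))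
        simpa using this
      | succ j =>
        have := U_mem_evenChebyshevSpan (j := j) (N := N + 1) (by omega)
        simpa using this
  | zero => simp
  | add f g _ _ hf hg => rw [mul_add]; exact Submodule.add_mem _ hf hg
  | smul c f _ hf => rw [mul_smul_comm]; exact Submodule.smul_mem _ _ hf

theorem X_pow_mem_evenChebyshevSpan {a N : ℕ} (h : a ≤ N) :
    (Polynomial.X ^ (2 * a) : Polynomial ℝ) ∈ evenChebyshevSpan N := by
  induction a generalizing N with
  | zero => simpa using U_mem_evenChebyshevSpan (j := 0) (N := N) (by omega)
  | succ a ih =>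
    obtain ⟨N, rfl⟩ : ∃ M, N = M + 1 := ⟨N - 1, by omega⟩
    rw [show 2 * (a + 1) = 2 + 2 * a by ring, pow_add]
    exact X_sq_mul_mem_evenChebyshevSpan (ih (by omega))

/-- The Chebyshev polynomials of even degree at most `2N` reproduce even polynomials. -/
theorem sum_U_mul_semicirclePairing (N : ℕ) {f : Polynomial ℝ}
    (hf : f ∈ evenChebyshevSpan N) (s : ℝ) :
    ∑ j ∈ Finset.range (N + 1), (Polynomial.Chebyshev.U ℝ (2 * j)).eval s *
      semicirclePairing f (Polynomial.Chebyshev.U ℝ (2 * j)) = Real.pi / 4 * f.eval s := by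
  unfold evenChebyshevSpan at hf
  induction hf using Submodule.span_induction with
  | mem f hf =>
    obtain ⟨i, hi, rfl⟩ := hf
    simp only [semicirclePairing_U, mul_ite, mul_zero]
    rw [Finset.sum_ite_eq, if_pos (Finset.mem_range.2 (Nat.lt_succ_of_le hi)), mul_comm]
  | zero => simp [semicirclePairing]
  | add f g _ _ hf hg =>
    simp only [semicirclePairing_add_left, mul_add, Finset.sum_add_distrib, hf, hg,
      Polynomial.eval_add]
  | smul a f _ hf =>
    simp only [semicirclePairing_smul_left, mul_left_comm _ a, ← Finset.mul_sum, hf,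
      Polynomial.eval_smul, smul_eq_mul]

end

/-! ### The weighted inner product and its reproducing kernel. -/

noncomputable section

open MvPolynomial Set

variable {d k : ℕ}

theorem exists_abs_polyEval_le_of_totalDegree_le {p : MvPolynomial (Fin d) ℝ} {N : ℕ}
    (hp : p.totalDegree ≤ N) :
    ∃ C : ℝ, 0 ≤ C ∧ ∀ x : EuclideanSpace ℝ (Fin d), 1 ≤ ‖x‖ → |polyEval x p| ≤ C * ‖x‖ ^ N := by
  choose C hC0 hC using fun n => exists_abs_polyEval_le (homogeneousComponent_isHomogeneous n p)
  refine ⟨∑ n ∈ Finset.range (p.totalDegree + 1), C n, Finset.sum_nonneg fun n _ => hC0 n,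
    fun x hx => ?_⟩
  have hs : polyEval x p =
      ∑ n ∈ Finset.range (p.totalDegree + 1), polyEval x (homogeneousComponent n p) := by
    conv_lhs => rw [← sum_homogeneousComponent p]
    simp [polyEval]
  rw [hs, Finset.sum_mul]
  refine (Finset.abs_sum_le_sum_abs _ _).trans (Finset.sum_le_sum fun n hn => (hC n x).trans ?_)
  have := Finset.mem_range.1 hn
  exact mul_le_mul_of_nonneg_left (pow_le_pow_right₀ hx (by omega)) (hC0 n)

theorem measurableSet_domainΩ : MeasurableSet (domainΩ d) :=
  measurableSet_le measurable_const measurable_norm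

/-- The product of polynomials is O(r^(4k)) and the weight is at most r^(-4k-d-1), so the integrand
is O(r^(-d-1)), integrable in dimension d. -/
theorem integrableOn_mul_weightW {p q : MvPolynomial (Fin d) ℝ} (hp : p ∈ evenPolys d k)
    (hq : q ∈ evenPolys d k) :
    IntegrableOn (fun x => polyEval x p * polyEval x q * weightW d k ‖x‖) (domainΩ d) volume := by
  obtain ⟨C, hC0, hC⟩ := exists_abs_polyEval_le_of_totalDegree_le hp.1
  obtain ⟨D, hD0, hD⟩ := exists_abs_polyEval_le_of_totalDegree_le hq.1
  have hi : Integrable (fun x : EuclideanSpace ℝ (Fin d) =>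
      C * D * 2 ^ (d + 1) * (1 + ‖x‖) ^ (-((d : ℝ) + 1))) volume := by
    refine (integrable_one_add_norm ?_).const_mul _
    simp
  refine hi.integrableOn.mono' ?_ ?_
  · have hW : Measurable (weightW d k) := by
      unfold weightW
      fun_prop
    exact (((continuous_polyEval p).mul (continuous_polyEval q)).measurable.mul
      (hW.comp measurable_norm)).aestronglyMeasurable
  · filter_upwards [ae_restrict_mem measurableSet_domainΩ] with x hx
    have hx1 : 1 ≤ ‖x‖ := hx
    have hx0 : 0 < ‖x‖ := zero_lt_one.trans_le hx1
    have hsq : Real.sqrt (‖x‖ ^ 2 - 1) ≤ ‖x‖ := by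
      refine (Real.sqrt_le_sqrt (by linarith)).trans (Real.sqrt_sq hx0.le).le
    have hpow : ‖x‖⁻¹ ^ (d + 1) ≤ 2 ^ (d + 1) * (1 + ‖x‖) ^ (-((d : ℝ) + 1)) := by
      have h2 : (1 + ‖x‖) ^ (-((d : ℝ) + 1)) = ((1 + ‖x‖)⁻¹) ^ (d + 1) := by
        rw [Real.rpow_neg (by positivity), ← Nat.cast_add_one, Real.rpow_natCast, inv_pow]
      rw [h2, ← mul_pow]
      refine pow_le_pow_left₀ (by positivity) ?_ _
      rw [← div_eq_mul_inv, inv_eq_one_div, div_le_div_iff₀ hx0 (by positivity)]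
      linarith
    calc ‖polyEval x p * polyEval x q * weightW d k ‖x‖‖
        = |polyEval x p| * |polyEval x q| * (Real.sqrt (‖x‖ ^ 2 - 1) / ‖x‖ ^ (4 * k + d + 2)) := by
          rw [Real.norm_eq_abs, abs_mul, abs_mul, weightW, abs_of_nonneg (by positivity :
            0 ≤ Real.sqrt (‖x‖ ^ 2 - 1) / ‖x‖ ^ (4 * k + d + 2))]
      _ ≤ (C * ‖x‖ ^ (2 * k)) * (D * ‖x‖ ^ (2 * k)) * (‖x‖ / ‖x‖ ^ (4 * k + d + 2)) := by
          gcongr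
          · exact hC x hx1
          · exact hD x hx1
      _ = C * D * ‖x‖⁻¹ ^ (d + 1) := by
          rw [inv_pow, show 4 * k + d + 2 = 2 * k + 2 * k + (d + 1) + 1 by ring]
          simp only [pow_add]
          field_simp
      _ ≤ C * D * (2 ^ (d + 1) * (1 + ‖x‖) ^ (-((d : ℝ) + 1))) := by gcongr
      _ = _ := by ring

/-- The pairing of two polynomials with respect to `Ω` and `W`. -/
def weightedPairing (d k : ℕ) (p q : MvPolynomial (Fin d) ℝ) : ℝ :=
  specialIntegral d k fun x => polyEval x p * polyEval x q

theorem weightedPairing_comm (p q : MvPolynomial (Fin d) ℝ) :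
    weightedPairing d k p q = weightedPairing d k q p := by
  simp only [weightedPairing, mul_comm]

theorem weightedPairing_add_left {p q r : MvPolynomial (Fin d) ℝ} (hp : p ∈ evenPolys d k)
    (hq : q ∈ evenPolys d k) (hr : r ∈ evenPolys d k) :
    weightedPairing d k (p + q) r = weightedPairing d k p r + weightedPairing d k q r := by
  simp only [weightedPairing, specialIntegral]
  rw [← integral_add (integrableOn_mul_weightW hp hr) (integrableOn_mul_weightW hq hr)]
  simp [polyEval, add_mul]

theorem weightedPairing_smul_left (c : ℝ) (p r : MvPolynomial (Fin d) ℝ) :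
    weightedPairing d k (c • p) r = c * weightedPairing d k p r := by
  simp only [weightedPairing, specialIntegral]
  rw [← integral_const_mul]
  simp [polyEval, smul_eval, mul_assoc]

theorem weightedPairing_sum_left {ι : Type*} (s : Finset ι) {f : ι → MvPolynomial (Fin d) ℝ}
    {r : MvPolynomial (Fin d) ℝ} (hf : ∀ i ∈ s, f i ∈ evenPolys d k) (hr : r ∈ evenPolys d k) :
    weightedPairing d k (∑ i ∈ s, f i) r = ∑ i ∈ s, weightedPairing d k (f i) r := by
  classical
  induction s using Finset.induction_on with
  | empty => simp [weightedPairing, specialIntegral, polyEval]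
  | insert a s ha ih =>
    rw [Finset.sum_insert ha, Finset.sum_insert ha, weightedPairing_add_left
      (hf a (Finset.mem_insert_self a s))
      (Submodule.sum_mem _ fun i hi => hf i (Finset.mem_insert_of_mem hi)) hr,
      ih fun i hi => hf i (Finset.mem_insert_of_mem hi)]

theorem weightW_nonneg {r : ℝ} (hr : 1 ≤ r) : 0 ≤ weightW d k r := by
  unfold weightW
  positivity

theorem weightedPairing_self_nonneg (p : MvPolynomial (Fin d) ℝ) :
    0 ≤ weightedPairing d k p p :=
  setIntegral_nonneg measurableSet_domainΩ fun _ hx =>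
    mul_nonneg (mul_self_nonneg _) (weightW_nonneg hx)

theorem eq_zero_of_weightedPairing_self [NeZero d] {p : MvPolynomial (Fin d) ℝ}
    (hp : p ∈ evenPolys d k) (h : weightedPairing d k p p = 0) : p = 0 := by
  have hae := (setIntegral_eq_zero_iff_of_nonneg_ae
    ((ae_restrict_mem measurableSet_domainΩ).mono fun x hx =>
      mul_nonneg (mul_self_nonneg _) (weightW_nonneg hx)) (integrableOn_mul_weightW hp hp)).1 h
  set U : Set (EuclideanSpace ℝ (Fin d)) := {x | 1 < ‖x‖}
  have hU : IsOpen U := isOpen_lt continuous_const continuous_norm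
  have hUΩ : U ⊆ domainΩ d := fun x hx => le_of_lt (show 1 < ‖x‖ from hx)
  have hae' : (fun x => polyEval x p) =ᵐ[volume.restrict U] fun _ => 0 := by
    filter_upwards [ae_restrict_of_ae_restrict_of_subset hUΩ hae,
      ae_restrict_mem hU.measurableSet] with x hx hxU
    have hx1 : 1 < ‖x‖ := hxU
    have hW : 0 < weightW d k ‖x‖ := by
      have h1 : 0 < Real.sqrt (‖x‖ ^ 2 - 1) := Real.sqrt_pos.2 (by nlinarith)
      have h2 : 0 < ‖x‖ := by linarith
      unfold weightW
      positivity
    have h3 : polyEval x p * polyEval x p * weightW d k ‖x‖ = 0 := hx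
    simpa [hW.ne'] using h3
  have hEq := Measure.eqOn_open_of_ae_eq hae' hU (continuous_polyEval p).continuousOn
    continuousOn_const
  -- The open set U contains the box (1, ∞)^d, and a polynomial vanishing on a product of infinite
  -- sets is zero.
  refine MvPolynomial.funext_set (fun _ => Ioi (1 : ℝ)) (fun _ => Ioi_infinite 1) fun x hx => ?_
  have hxU : WithLp.toLp 2 x ∈ U := by
    have h1 : (1 : ℝ) < x 0 := hx 0 (mem_univ _)
    exact (h1.trans_le (le_abs_self _)).trans_le (PiLp.norm_apply_le (WithLp.toLp 2 x) 0)
  simpa [polyEval] using hEq hxU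

/-- The inner product on the even polynomials of degree at most `2k`. -/
abbrev evenPolysCore (d k : ℕ) [NeZero d] : InnerProductSpace.Core ℝ (evenPolys d k) where
  inner p q := weightedPairing d k p q
  conj_inner_symm _ _ := weightedPairing_comm _ _
  re_inner_nonneg _ := weightedPairing_self_nonneg _
  add_left p q r := weightedPairing_add_left p.2 q.2 r.2
  smul_left _ _ _ := weightedPairing_smul_left _ _ _
  definite p hp := Subtype.ext (eq_zero_of_weightedPairing_self p.2 hp)

instance finite_evenPolys : Module.Finite ℝ (evenPolys d k) :=
  Submodule.finiteDimensional_of_le (S₂ := restrictTotalDegree (Fin d) ℝ (2 * k)) fun _ hp =>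
    (mem_restrictTotalDegree _ _ _).2 hp.1

theorem exists_isOrthonormalBasis [NeZero d] :
    ∃ (n : ℕ) (b : Module.Basis (Fin n) ℝ (evenPolys d k)), IsOrthonormalBasis d k b := by
  let _ := (evenPolysCore d k).toNormedAddCommGroup
  let _ := InnerProductSpace.ofCore (evenPolysCore d k).toCore
  refine ⟨_, (stdOrthonormalBasis ℝ (evenPolys d k)).toBasis, fun i j => ?_⟩
  have := orthonormal_iff_ite.1 (stdOrthonormalBasis ℝ (evenPolys d k)).orthonormal i j
  simp only [OrthonormalBasis.coe_toBasis]
  exact this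

section Kernel

variable {n : ℕ} {b : Module.Basis (Fin n) ℝ (evenPolys d k)}

theorem coe_eq_sum_repr (b : Module.Basis (Fin n) ℝ (evenPolys d k)) (p : evenPolys d k) :
    (p : MvPolynomial (Fin d) ℝ) = ∑ j, b.repr p j • (b j : MvPolynomial (Fin d) ℝ) := by
  have h := congrArg (evenPolys d k).subtype (b.sum_repr p)
  rw [map_sum] at h
  simpa only [map_smul, Submodule.subtype_apply] using h.symm

theorem IsOrthonormalBasis.repr_eq (hb : IsOrthonormalBasis d k b) (p : evenPolys d k)
    (i : Fin n) : b.repr p i = weightedPairing d k p (b i) := by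
  conv_rhs => rw [coe_eq_sum_repr b p]
  rw [weightedPairing_sum_left _ (fun j _ => Submodule.smul_mem _ _ (b j).2) (b i).2]
  have hb' : ∀ j, weightedPairing d k (b j) (b i) = if j = i then 1 else 0 := fun j => hb j i
  simp [weightedPairing_smul_left, hb']

theorem IsOrthonormalBasis.polyEval_eq (hb : IsOrthonormalBasis d k b)
    {p : MvPolynomial (Fin d) ℝ} (hp : p ∈ evenPolys d k) (x : EuclideanSpace ℝ (Fin d)) :
    polyEval x p = ∑ i, weightedPairing d k p (b i) * polyEval x (b i : MvPolynomial (Fin d) ℝ) := by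
  have h : p = ∑ j, b.repr ⟨p, hp⟩ j • (b j : MvPolynomial (Fin d) ℝ) :=
    coe_eq_sum_repr b ⟨p, hp⟩
  conv_lhs => rw [h]
  simp only [hb.repr_eq, polyEval, map_sum, smul_eval]

/-- The section at `x` of the kernel of an orthonormal basis is the only even polynomial that
represents evaluation at `x`. -/
theorem IsOrthonormalBasis.kernel_eq (hb : IsOrthonormalBasis d k b)
    {x : EuclideanSpace ℝ (Fin d)} {q : MvPolynomial (Fin d) ℝ} (hq : q ∈ evenPolys d k)
    (hrep : ∀ p ∈ evenPolys d k, weightedPairing d k p q = polyEval x p)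
    (y : EuclideanSpace ℝ (Fin d)) :
    ∑ i, polyEval x (b i : MvPolynomial (Fin d) ℝ) * polyEval y (b i : MvPolynomial (Fin d) ℝ) =
      polyEval y q := by
  rw [hb.polyEval_eq hq y]
  refine Finset.sum_congr rfl fun i _ => ?_
  rw [weightedPairing_comm, hrep _ (b i).2]

theorem IsOrthonormalBasis.weightedPairing_section (hb : IsOrthonormalBasis d k b)
    (x : EuclideanSpace ℝ (Fin d)) {p : MvPolynomial (Fin d) ℝ} (hp : p ∈ evenPolys d k) :
    weightedPairing d k p (∑ i, polyEval x (b i : MvPolynomial (Fin d) ℝ) •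
      (b i : MvPolynomial (Fin d) ℝ)) = polyEval x p := by
  rw [hb.polyEval_eq hp x, weightedPairing_comm,
    weightedPairing_sum_left _ (fun j _ => Submodule.smul_mem _ _ (b j).2) hp]
  refine Finset.sum_congr rfl fun i _ => ?_
  rw [weightedPairing_smul_left, weightedPairing_comm, mul_comm]

end Kernel

theorem existsUnique_isReproducingKernel [NeZero d] :
    ∃! K : EuclideanSpace ℝ (Fin d) → EuclideanSpace ℝ (Fin d) → ℝ, IsReproducingKernel d k K := by
  obtain ⟨n, b, hb⟩ := exists_isOrthonormalBasis (d := d) (k := k)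
  refine ⟨_, ⟨n, b, hb, fun x y => rfl⟩, ?_⟩
  rintro K ⟨n', b', hb', hK⟩
  funext x y
  -- The section of the kernel built from `b` represents evaluation at x, so the kernel built from
  -- `b'` must agree with it.
  rw [hK, hb'.kernel_eq (Submodule.sum_mem _ fun i _ => Submodule.smul_mem _ _ (b i).2)
    (fun p hp => hb.weightedPairing_section x hp)]
  simp [polyEval, smul_eval]

/-! ### The explicit kernel represents evaluation. -/

theorem mem_evenPolys_of_isHomogeneous {p : MvPolynomial (Fin d) ℝ} {a : ℕ}
    (hp : p.IsHomogeneous (2 * a)) (ha : a ≤ k) : p ∈ evenPolys d k := by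
  refine ⟨hp.totalDegree_le.trans (by omega), fun x => ?_⟩
  rw [← neg_one_smul ℝ x, polyEval_smul hp, pow_mul]
  simp

/-- Averaging p(x) and p(-x) multiplies the component of degree n by (1+(-1)^n)/2, which kills the
odd ones. -/
theorem mem_span_of_mem_evenPolys {p : MvPolynomial (Fin d) ℝ} (hp : p ∈ evenPolys d k) :
    p ∈ Submodule.span ℝ {q : MvPolynomial (Fin d) ℝ | ∃ a ≤ k, q.IsHomogeneous (2 * a)} := by
  have h : p = ∑ n ∈ Finset.range (p.totalDegree + 1),
      ((1 + (-1 : ℝ) ^ n) / 2) • homogeneousComponent n p := by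
    refine MvPolynomial.funext fun x => ?_
    have h1 : ∀ y : EuclideanSpace ℝ (Fin d), polyEval y p =
        ∑ n ∈ Finset.range (p.totalDegree + 1), polyEval y (homogeneousComponent n p) := by
      intro y
      conv_lhs => rw [← sum_homogeneousComponent p]
      simp [polyEval]
    have h2 := hp.2 (WithLp.toLp 2 x)
    have h3 : polyEval (-WithLp.toLp 2 x) p = ∑ n ∈ Finset.range (p.totalDegree + 1),
        (-1) ^ n * polyEval (WithLp.toLp 2 x) (homogeneousComponent n p) := by
      rw [h1]
      refine Finset.sum_congr rfl fun n _ => ?_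
      rw [← neg_one_smul ℝ (WithLp.toLp 2 x),
        polyEval_smul (homogeneousComponent_isHomogeneous n p)]
    have h4 : polyEval (WithLp.toLp 2 x) p = ∑ n ∈ Finset.range (p.totalDegree + 1),
        (1 + (-1 : ℝ) ^ n) / 2 * polyEval (WithLp.toLp 2 x) (homogeneousComponent n p) := by
      have h5 : polyEval (WithLp.toLp 2 x) p =
        (polyEval (WithLp.toLp 2 x) p + polyEval (-WithLp.toLp 2 x) p) / 2 := by
        rw [h2]
        ring
      rw [h5, h3, h1, ← Finset.sum_add_distrib, Finset.sum_div]
      refine Finset.sum_congr rfl fun n _ => ?_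
      ring
    simpa [polyEval, smul_eval] using h4
  rw [h]
  refine Submodule.sum_mem _ fun n hn => ?_
  rcases Nat.even_or_odd' n with ⟨a, rfl | rfl⟩
  · have := Finset.mem_range.1 hn
    have := hp.1
    exact Submodule.smul_mem _ _ (Submodule.subset_span
      ⟨a, by omega, homogeneousComponent_isHomogeneous _ _⟩)
  · simp [pow_succ, pow_mul]

/-- The polynomial that equals `|y|^{2M} C_{2j}^{(1)}(1 / |y|)` for `j ≤ M`, `y ≠ 0`. -/
def radialPoly (d M j : ℕ) : MvPolynomial (Fin d) ℝ :=
  ∑ i ∈ Finset.range (2 * j / 2 + 1),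
    C (((-1) ^ i * (ascPochhammer ℝ (2 * j - i)).eval 1
        / ((Nat.factorial i : ℝ) * (Nat.factorial (2 * j - 2 * i) : ℝ))) * 2 ^ (2 * j - 2 * i))
      * normSqPoly d ^ (M - (j - i))

theorem polyEval_radialPoly {M j : ℕ} (hj : j ≤ M) {y : EuclideanSpace ℝ (Fin d)} (hy : y ≠ 0) :
    polyEval y (radialPoly d M j) = ‖y‖ ^ (2 * M) * (gegenbauer (2 * j) 1).eval (1 / ‖y‖) := by
  have hq := polyEval_normSqPoly y
  simp only [polyEval] at hq ⊢
  rw [radialPoly, gegenbauer, map_sum, Polynomial.eval_finsetSum, Finset.mul_sum]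
  refine Finset.sum_congr rfl fun i hi => ?_
  have hi' : i ≤ j := by have := Finset.mem_range.1 hi; omega
  simp only [map_mul, map_pow, eval_C, hq, Polynomial.eval_mul, Polynomial.eval_C,
    Polynomial.eval_pow, Polynomial.eval_X, Polynomial.eval_ofNat, mul_pow]
  have hy0 : ‖y‖ ≠ 0 := norm_ne_zero_iff.2 hy
  -- The bound j ≤ M keeps the exponent M - (j - i) from being truncated.
  have : ‖y‖ ^ (2 * M) * (1 / ‖y‖) ^ (2 * j - 2 * i) = (‖y‖ ^ 2) ^ (M - (j - i)) := by
    rw [← pow_mul, show 2 * M = 2 * (M - (j - i)) + (2 * j - 2 * i) by omega, pow_add, one_div,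
      inv_pow]
    field_simp
  rw [← this]
  ring

theorem radialPoly_mul_zonalPoly_mem {m j : ℕ} (hm : m ≤ k) (ξ : EuclideanSpace ℝ (Fin d)) :
    radialPoly d (k - m) j * zonalPoly (2 * m) ξ ∈ evenPolys d k := by
  rw [radialPoly, Finset.sum_mul]
  refine Submodule.sum_mem _ fun i _ => ?_
  have h := ((isHomogeneous_normSqPoly (d := d).pow (k - m - (j - i))).C_mul
    (((-1) ^ i * (ascPochhammer ℝ (2 * j - i)).eval 1
        / ((Nat.factorial i : ℝ) * (Nat.factorial (2 * j - 2 * i) : ℝ))) *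
          2 ^ (2 * j - 2 * i))).mul (isHomogeneous_zonalPoly (2 * m) ξ)
  rw [← mul_add] at h
  exact mem_evenPolys_of_isHomogeneous h (by omega)

theorem integral_Ioi_radial {a m : ℕ} (hd : 1 ≤ d) (ha : a ≤ k) (hm : m ≤ k) (f : Polynomial ℝ) :
    ∫ r in Ioi (0 : ℝ), r ^ (2 * a + 2 * m + (d - 1)) * (Ici (1 : ℝ)).indicator
      (fun r => r ^ (2 * (k - m)) * f.eval (1 / r) * weightW d k r) r =
      semicirclePairing (Polynomial.X ^ (2 * (k - a))) f := by
  have hpow : ∀ r : ℝ, r ≠ 0 → ∀ (A B C : ℕ) (s t : ℝ),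
      r ^ A * (r ^ B * t * (s / r ^ (C + A + B + 3))) = (1 / r) ^ C * t * (s / r ^ 3) := by
    intro r hr A B C s t
    rw [pow_add r (C + A + B) 3, pow_add r (C + A) B, pow_add r C A, one_div, inv_pow]
    field_simp
  have h1 : ∀ r : ℝ, r ^ (2 * a + 2 * m + (d - 1)) * (Ici (1 : ℝ)).indicator
      (fun r => r ^ (2 * (k - m)) * f.eval (1 / r) * weightW d k r) r =
      (Ici (1 : ℝ)).indicator (fun r => (1 / r) ^ (2 * (k - a)) * f.eval (1 / r) *
        (Real.sqrt (r ^ 2 - 1) / r ^ 3)) r := by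
    intro r
    by_cases hr : r ∈ Ici (1 : ℝ)
    · have hr0 : r ≠ 0 := (zero_lt_one.trans_le hr).ne'
      rw [indicator_of_mem hr, indicator_of_mem hr, weightW,
        -- The weight's exponent absorbs all powers of r in front and leaves r^(-2(k-a)) and the
        -- r^(-3) required by the substitution t = 1/r.
        show 4 * k + d + 2 = 2 * (k - a) + (2 * a + 2 * m + (d - 1)) + 2 * (k - m) + 3 by omega]
      exact hpow r hr0 _ _ _ _ _
    · rw [indicator_of_notMem hr, indicator_of_notMem hr, mul_zero]
  have h2 : (Ioi (0 : ℝ)) ∩ Ici 1 = Ici 1 :=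
    inter_eq_right.2 fun r hr => zero_lt_one.trans_le (mem_Ici.1 hr)
  simp only [h1]
  rw [setIntegral_indicator measurableSet_Ici, h2, integral_Ici_eq_integral_Ioi,
    integral_Ioi_inv_mul_sqrt fun t => t ^ (2 * (k - a)) * f.eval t, semicirclePairing,
    intervalIntegral.integral_of_le (by positivity), integral_Ioc_eq_integral_Ioo]
  simp

theorem weightedPairing_radialPoly_mul_zonalPoly [NeZero d] {a m j : ℕ}
    {p : MvPolynomial (Fin d) ℝ} (hp : p.IsHomogeneous (2 * a)) (ha : a ≤ k) (hm : m ≤ k)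
    (hj : j ≤ k - m) (ξ : EuclideanSpace ℝ (Fin d)) :
    weightedPairing d k p (radialPoly d (k - m) j * zonalPoly (2 * m) ξ) =
      sphereIntegral d (p * zonalPoly (2 * m) ξ) *
        semicirclePairing (Polynomial.X ^ (2 * (k - a))) (gegenbauer (2 * j) 1) := by
  rw [← integral_Ioi_radial (d := d) NeZero.one_le ha hm,
    ← integral_polyEval_mul_radial (hp.mul (isHomogeneous_zonalPoly (2 * m) ξ)), weightedPairing,
    specialIntegral, ← integral_indicator measurableSet_domainΩ]
  refine integral_congr_ae ?_
  filter_upwards [ae_ne_zero] with x hx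
  by_cases h : 1 ≤ ‖x‖
  · rw [indicator_of_mem (show x ∈ domainΩ d from h), indicator_of_mem (show ‖x‖ ∈ Ici 1 from h),
      ← polyEval_radialPoly hj hx]
    simp only [polyEval, map_mul]
    ring
  · rw [indicator_of_notMem (show x ∉ domainΩ d from h),
      indicator_of_notMem (show ‖x‖ ∉ Ici 1 from h), mul_zero]

/-- The polynomial in `y` that the explicit formula for the kernel gives at a fixed `x ≠ 0`. -/
def kernelSection (d k : ℕ) (x : EuclideanSpace ℝ (Fin d)) : MvPolynomial (Fin d) ℝ :=
  (4 * ‖x‖ ^ (2 * k) / (Real.pi * ((d : ℝ) - 2) * sphereArea d)) •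
    ∑ m ∈ Finset.range (k + 1), ∑ j ∈ Finset.range (k - m + 1),
      (((d : ℝ) + 4 * m - 2) * (gegenbauer (2 * j) 1).eval (1 / ‖x‖)) •
        (radialPoly d (k - m) j * zonalPoly (2 * m) (‖x‖⁻¹ • x))

theorem smul_radialPoly_mul_zonalPoly_mem (x : EuclideanSpace ℝ (Fin d)) (c : ℕ → ℕ → ℝ) :
    ∀ m ∈ Finset.range (k + 1), ∀ j ∈ Finset.range (k - m + 1),
      c m j • (radialPoly d (k - m) j * zonalPoly (2 * m) x) ∈ evenPolys d k :=
  fun _ hm _ _ => Submodule.smul_mem _ _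
    (radialPoly_mul_zonalPoly_mem (Nat.lt_succ_iff.1 (Finset.mem_range.1 hm)) x)

theorem kernelSection_mem (x : EuclideanSpace ℝ (Fin d)) : kernelSection d k x ∈ evenPolys d k := by
  unfold kernelSection
  refine Submodule.smul_mem _ _ (Submodule.sum_mem _ fun m hm => Submodule.sum_mem _ fun j hj => ?_)
  exact smul_radialPoly_mul_zonalPoly_mem _ (fun m j =>
    ((d : ℝ) + 4 * m - 2) * (gegenbauer (2 * j) 1).eval (1 / ‖x‖)) m hm j hj

theorem polyEval_zonalPoly {ξ y : EuclideanSpace ℝ (Fin d)} (hξ : ‖ξ‖ = 1) (hy : y ≠ 0) (n : ℕ) :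
    polyEval y (zonalPoly n ξ) =
      ‖y‖ ^ n * (gegenbauer n (((d : ℝ) - 2) / 2)).eval (inner ℝ ξ y / ‖y‖) := by
  have hn : ‖‖y‖⁻¹ • y‖ = 1 := norm_smul_inv_norm (𝕜 := ℝ) hy
  rw [polyEval_eq_norm_pow_mul (isHomogeneous_zonalPoly n ξ) hy,
    polyEval_zonalPoly_of_norm_eq_one hξ hn, inner_smul_right,
    inv_mul_eq_div]

theorem polyEval_kernelSection {x y : EuclideanSpace ℝ (Fin d)} (hx : x ≠ 0) (hy : y ≠ 0) :
    polyEval y (kernelSection d k x) =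
      4 * (‖x‖ * ‖y‖) ^ (2 * k) / (Real.pi * ((d : ℝ) - 2) * sphereArea d) *
        ∑ m ∈ Finset.range (k + 1), ∑ j ∈ Finset.range (k - m + 1),
          ((d : ℝ) + 4 * (m : ℝ) - 2) * (gegenbauer (2 * j) 1).eval (1 / ‖x‖)
            * (gegenbauer (2 * j) 1).eval (1 / ‖y‖)
            * (gegenbauer (2 * m) (((d : ℝ) - 2) / 2)).eval (inner ℝ x y / (‖x‖ * ‖y‖)) := by
  have hξ : ‖‖x‖⁻¹ • x‖ = 1 := norm_smul_inv_norm (𝕜 := ℝ) hx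
  have hin : inner ℝ (‖x‖⁻¹ • x) y / ‖y‖ = inner ℝ x y / (‖x‖ * ‖y‖) := by
    rw [real_inner_smul_left, inv_mul_eq_div, div_div]
  have hterm : ∀ m ∈ Finset.range (k + 1), ∀ j ∈ Finset.range (k - m + 1),
      polyEval y ((((d : ℝ) + 4 * m - 2) * (gegenbauer (2 * j) 1).eval (1 / ‖x‖)) •
        (radialPoly d (k - m) j * zonalPoly (2 * m) (‖x‖⁻¹ • x))) =
      ‖y‖ ^ (2 * k) * (((d : ℝ) + 4 * (m : ℝ) - 2) * (gegenbauer (2 * j) 1).eval (1 / ‖x‖)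
            * (gegenbauer (2 * j) 1).eval (1 / ‖y‖)
            * (gegenbauer (2 * m) (((d : ℝ) - 2) / 2)).eval (inner ℝ x y / (‖x‖ * ‖y‖))) := by
    intro m hm j hj
    have hm' := Finset.mem_range.1 hm
    have hj' := Finset.mem_range.1 hj
    have h1 := polyEval_radialPoly (d := d) (by omega : j ≤ k - m) hy
    have h2 := polyEval_zonalPoly hξ hy (2 * m)
    rw [hin] at h2
    simp only [polyEval, smul_eval, map_mul] at h1 h2 ⊢
    rw [h1, h2, show 2 * k = 2 * (k - m) + 2 * m by omega, pow_add]
    ring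
  have hsum : polyEval y (kernelSection d k x) =
      4 * ‖x‖ ^ (2 * k) / (Real.pi * ((d : ℝ) - 2) * sphereArea d) *
      ∑ m ∈ Finset.range (k + 1), ∑ j ∈ Finset.range (k - m + 1),
      polyEval y ((((d : ℝ) + 4 * m - 2) * (gegenbauer (2 * j) 1).eval (1 / ‖x‖)) •
        (radialPoly d (k - m) j * zonalPoly (2 * m) (‖x‖⁻¹ • x))) := by
    simp only [kernelSection, polyEval, smul_eval, map_sum]
  rw [hsum, Finset.sum_congr rfl fun m hm => Finset.sum_congr rfl fun j hj => hterm m hm j hj]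
  simp only [← Finset.mul_sum]
  rw [mul_pow]
  ring

theorem weightedPairing_kernelSection_of_isHomogeneous (hd : 3 ≤ d)
    {x : EuclideanSpace ℝ (Fin d)} (hx : x ≠ 0) {p : MvPolynomial (Fin d) ℝ} {a : ℕ}
    (hp : p.IsHomogeneous (2 * a)) (ha : a ≤ k) :
    weightedPairing d k p (kernelSection d k x) = polyEval x p := by
  have : NeZero d := ⟨by omega⟩
  have hd2 : 2 ≤ d := by omega
  set ξ := ‖x‖⁻¹ • x with hξdef
  have hξ : ‖ξ‖ = 1 := norm_smul_inv_norm (𝕜 := ℝ) hx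
  have hpV := mem_evenPolys_of_isHomogeneous hp ha
  have hmem := smul_radialPoly_mul_zonalPoly_mem (k := k) ξ fun m j =>
    ((d : ℝ) + 4 * m - 2) * (gegenbauer (2 * j) 1).eval (1 / ‖x‖)
  have hinner : ∀ m ∈ Finset.range (k + 1), ∑ j ∈ Finset.range (k - m + 1),
      weightedPairing d k ((((d : ℝ) + 4 * m - 2) * (gegenbauer (2 * j) 1).eval (1 / ‖x‖)) •
        (radialPoly d (k - m) j * zonalPoly (2 * m) ξ)) p =
      ((d : ℝ) + 4 * m - 2) * sphereIntegral d (p * zonalPoly (2 * m) ξ) *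
        (Real.pi / 4 * (1 / ‖x‖) ^ (2 * (k - a))) := by
    intro m hm
    have hm' : m ≤ k := Nat.lt_succ_iff.1 (Finset.mem_range.1 hm)
    have hterm : ∀ j ∈ Finset.range (k - m + 1), weightedPairing d k
        ((((d : ℝ) + 4 * m - 2) * (gegenbauer (2 * j) 1).eval (1 / ‖x‖)) •
        (radialPoly d (k - m) j * zonalPoly (2 * m) ξ)) p =
        ((d : ℝ) + 4 * m - 2) * sphereIntegral d (p * zonalPoly (2 * m) ξ) *
          ((Polynomial.Chebyshev.U ℝ (2 * j)).eval (1 / ‖x‖) * semicirclePairing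
            (Polynomial.X ^ (2 * (k - a))) (Polynomial.Chebyshev.U ℝ (2 * j))) := by
      intro j hj
      have hU := gegenbauer_one_eq_U (2 * j)
      push_cast at hU
      rw [weightedPairing_smul_left, weightedPairing_comm,
        weightedPairing_radialPoly_mul_zonalPoly hp ha hm'
          (Nat.lt_succ_iff.1 (Finset.mem_range.1 hj)), hU]
      ring
    rw [Finset.sum_congr rfl hterm, ← Finset.mul_sum]
    -- For a < m the spherical factor vanishes. Otherwise k-a ≤ k-m, so t^(2(k-a)) lies in the span
    -- that the Chebyshev sum up to k-m reproduces.
    rcases lt_or_ge a m with h | h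
    · rw [sphereIntegral_mul_harmonic_eq_zero hd2 hp (isHomogeneous_zonalPoly _ ξ)
        (polyLaplacian_zonalPoly _ ξ) (by omega)]
      ring
    · rw [sum_U_mul_semicirclePairing _ (X_pow_mem_evenChebyshevSpan (by omega))]
      simp
  have hrange : ∑ m ∈ Finset.range (k + 1), ((d : ℝ) + 4 * m - 2) *
      sphereIntegral d (p * zonalPoly (2 * m) ξ) =
      ((d : ℝ) - 2) * sphereArea d * polyEval ξ p := by
    rw [← sum_sphereIntegral_mul_zonalPoly hd2 hξ hp]
    refine (Finset.sum_subset (Finset.range_mono (by omega)) fun m _ hm => ?_).symm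
    rw [Finset.mem_range] at hm
    rw [sphereIntegral_mul_harmonic_eq_zero hd2 hp (isHomogeneous_zonalPoly _ ξ)
        (polyLaplacian_zonalPoly _ ξ) (by omega), mul_zero]
  rw [kernelSection, weightedPairing_comm, weightedPairing_smul_left,
    weightedPairing_sum_left _ (fun m hm => Submodule.sum_mem _ (hmem m hm)) hpV,
    Finset.sum_congr rfl fun m hm => weightedPairing_sum_left _ (hmem m hm) hpV,
    Finset.sum_congr rfl hinner, ← Finset.sum_mul, hrange, polyEval_eq_norm_pow_mul hp hx,
    ← hξdef]
  have h1 : ((d : ℝ) - 2) ≠ 0 := by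
    have : (3 : ℝ) ≤ d := by exact_mod_cast hd
    linarith
  have h2 : sphereArea d ≠ 0 := sphereArea_pos.ne'
  have h3 : ‖x‖ ≠ 0 := norm_ne_zero_iff.2 hx
  have h4 : ‖x‖ ^ (2 * k) = ‖x‖ ^ (2 * a) * ‖x‖ ^ (2 * (k - a)) := by
    rw [← pow_add]
    congr 1
    omega
  have h5 := Real.pi_ne_zero
  generalize polyEval ξ p = t
  rw [h4, one_div, inv_pow]
  field_simp

theorem weightedPairing_kernelSection (hd : 3 ≤ d) {x : EuclideanSpace ℝ (Fin d)} (hx : x ≠ 0)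
    {p : MvPolynomial (Fin d) ℝ} (hp : p ∈ evenPolys d k) :
    weightedPairing d k p (kernelSection d k x) = polyEval x p := by
  -- Membership is carried through the induction because additivity of the pairing rests on
  -- integrability.
  have h : p ∈ evenPolys d k ∧ weightedPairing d k p (kernelSection d k x) = polyEval x p := by
    refine Submodule.span_induction (p := fun p _ => p ∈ evenPolys d k ∧
      weightedPairing d k p (kernelSection d k x) = polyEval x p) ?_ ?_ ?_ ?_
      (mem_span_of_mem_evenPolys hp)
    · rintro q ⟨a, ha, hq⟩
      exact ⟨mem_evenPolys_of_isHomogeneous hq ha,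
        weightedPairing_kernelSection_of_isHomogeneous hd hx hq ha⟩
    · exact ⟨Submodule.zero_mem _, by simp [weightedPairing, specialIntegral, polyEval]⟩
    · rintro q r - - ⟨hq, hq'⟩ ⟨hr, hr'⟩
      refine ⟨Submodule.add_mem _ hq hr, ?_⟩
      rw [weightedPairing_add_left hq hr (kernelSection_mem x), hq', hr']
      simp [polyEval]
    · rintro c q - ⟨hq, hq'⟩
      refine ⟨Submodule.smul_mem _ _ hq, ?_⟩
      rw [weightedPairing_smul_left, hq']
      simp [polyEval, smul_eval]
  exact h.2

end

theorem lemma4p2 (d k : ℕ) (hd : 3 ≤ d) :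
    -- the pairing on the space of even polynomials of degree at most 2k is well defined
    (∀ p ∈ evenPolys d k, ∀ q ∈ evenPolys d k,
      IntegrableOn (fun x => polyEval x p * polyEval x q * weightW d k ‖x‖)
        (domainΩ d) volume) ∧
    -- it has exactly one reproducing kernel
    (∃! K : EuclideanSpace ℝ (Fin d) → EuclideanSpace ℝ (Fin d) → ℝ,
      IsReproducingKernel d k K) ∧
    -- which is given by the explicit formula
    (∀ K : EuclideanSpace ℝ (Fin d) → EuclideanSpace ℝ (Fin d) → ℝ,
      IsReproducingKernel d k K →
      ∀ x y : EuclideanSpace ℝ (Fin d), x ≠ 0 → y ≠ 0 →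
        K x y =
          4 * (‖x‖ * ‖y‖) ^ (2 * k) / (Real.pi * ((d : ℝ) - 2) * sphereArea d) *
            ∑ m ∈ Finset.range (k + 1), ∑ j ∈ Finset.range (k - m + 1),
              ((d : ℝ) + 4 * (m : ℝ) - 2)
                * (gegenbauer (2 * j) 1).eval (1 / ‖x‖)
                * (gegenbauer (2 * j) 1).eval (1 / ‖y‖)
                * (gegenbauer (2 * m) (((d : ℝ) - 2) / 2)).eval
                    (inner ℝ x y / (‖x‖ * ‖y‖))) := by
  have : NeZero d := ⟨by omega⟩
  refine ⟨fun p hp q hq => integrableOn_mul_weightW hp hq, existsUnique_isReproducingKernel, ?_⟩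
  rintro K ⟨n, b, hb, hK⟩ x y hx hy
  rw [hK, hb.kernel_eq (kernelSection_mem x) fun p hp => weightedPairing_kernelSection hd hx hp,
    polyEval_kernelSection hx hy]
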